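/- A hypergraph $\mathcal G=(V,E)$ has a finite nonempty vertex set $V$ and a set $E$ of distinct edges, which are subsets of $V$; it is $k$-uniform if every edge has exactly $k$ vertices. It is connected if any two vertices are joined by a walk (a sequence of vertices in which consecutive vertices lie in a common edge). A connected $k$-uniform hypergraph with $n$ vertices and $m$ edges is unicyclic if $n-1=(k-1)m-1$. The adjacency matrix $\mathcal A_{\mathcal G}$ has zero diagonal and, for vertices $i\ne j$, entries $(\mathcal A_{\mathcal G})_{ij}=\sum_{e\in E:\ i,j\in e}\frac{1}{|e|-1}$; the spectral radius $\rho(\mathcal G)$ is the maximum modulus of the eigenvalues of $\mathcal A_{\mathcal G}$. Isomorphism $\cong$ means a bijection of the vertex sets that induces a bijection of the edge sets. For $g\ge 2$ and $k\ge 3$, the $k$-uniform hypercycle $\mathcal C_g$ has distinct vertices $v_i$ and $v_{a(i,j)}$ ($1\le i\le g$, $1\le j\le k-2$) and edges $e_i=\{v_i,v_{a(i,1)},\dots,v_{a(i,k-2)},v_{i+1}\}$ for $1\le i\le g$, where $v_{g+1}=v_1$ (for $g=2$ the two edges have exactly two common vertices). If $k-1$ divides $n$, then $\mathscr C(n,k)$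 denotes $\mathcal C_m$ with $m=\frac{n}{k-1}$, which has order $n$. The lollipop $Lop_{g,k,1;2}$ is obtained from $\mathcal C_g$ by adding $k-1$ new vertices and one new edge that consists of these and $v_{a(1,1)}$. **Theorem.** Let $k\ge 3$ and let $\mathcal G$ be a $k$-uniform unicyclic hypergraph of order $n$. Then $m=\frac{n}{k-1}$ is an integer with $m\ge 2$, the hypercycle $\mathscr C(n,k)$ is itself a $k$-uniform unicyclic hypergraph of order $n$, and the following hold. (1) $$\frac{k-1+\sqrt{(k-1)^2+8(k-1)}}{2(k-1)}\le\rho(\mathcal G),$$ with equality if and only if $\mathcal G\cong\mathscr C(n,k)$. (2) Suppose that $\mathcal G\not\cong\mathscr C(n,k)$. Then $g=\frac{n-k+1}{k-1}$ is an integer with $g\ge 2$, the lollipop $Lop_{g,k,1;2}$ is itself a $k$-uniform unicyclic hypergraph of order $n$ that is not isomorphic to $\mathscr C(n,k)$, and $$\rho(Lop_{g,k,1;2})\le\rho(\mathcal G),$$ with equality if and only if $\mathcal G\cong Lop_{g,k,1;2}$. -/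

import Mathlib

open scoped Hypergraph

namespace Hypergraph

/-- Every edge has exactly `k` vertices. -/
def IsUniform {α : Type*} (H : Hypergraph α) (k : ℕ) : Prop :=
  ∀ e ∈ E(H), e.ncard = k

/-- Any two vertices are joined by a walk, i.e. a sequence of vertices in which consecutive
vertices lie in a common edge. -/
def IsConnected {α : Type*} (H : Hypergraph α) : Prop :=
  V(H).Nonempty ∧ ∀ u ∈ V(H), ∀ v ∈ V(H), Relation.ReflTransGen H.Adj u v

/-- A `k`-uniform unicyclic hypergraph: finite, connected, `k`-uniform, and its order `n` and
number `m` of edges satisfy `n - 1 = (k - 1) m - 1`. -/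
structure IsUnicyclic {α : Type*} (H : Hypergraph α) (k : ℕ) : Prop where
  finite : V(H).Finite
  connected : H.IsConnected
  uniform : H.IsUniform k
  count : (V(H).ncard : ℤ) - 1 = ((k : ℤ) - 1) * (E(H).ncard : ℤ) - 1

/-- Isomorphism of hypergraphs with nonempty vertex sets: a map which is a bijection between the
vertex sets and which sends the edges of `H` bijectively to the edges of `K`. -/
def IsIsomorphic {α β : Type*} (H : Hypergraph α) (K : Hypergraph β) : Prop :=
  ∃ f : α → β, Set.BijOn f V(H) V(K) ∧ Set.BijOn (Set.image f) E(H) E(K)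

open Classical in
/-- The adjacency matrix: zero diagonal, and for `i ≠ j` the sum of `1 / (|e| - 1)` over all
edges `e` containing both `i` and `j`. -/
noncomputable def adjMatrix {α : Type*} (H : Hypergraph α) : Matrix V(H) V(H) ℝ :=
  Matrix.of fun i j =>
    if i = j then 0
    else ∑ᶠ e ∈ {e : Set α | e ∈ E(H) ∧ (i : α) ∈ e ∧ (j : α) ∈ e}, 1 / ((e.ncard : ℝ) - 1)

open Classical in
/-- The maximum modulus of the (complex) eigenvalues of the adjacency matrix. -/
noncomputable def specRadius {α : Type*} (H : Hypergraph α) [Finite V(H)] : ℝ :=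
  letI : Fintype V(H) := Fintype.ofFinite V(H)
  (spectralRadius ℂ (H.adjMatrix.map (fun x : ℝ => (x : ℂ)))).toReal

/-- The cyclic successor on `Fin g`. -/
def cyclicSucc {g : ℕ} (i : Fin g) : Fin g :=
  ⟨(i.val + 1) % g, Nat.mod_lt _ i.pos⟩

/-- The `i`-th edge of the `k`-uniform hypercycle: it consists of the junction vertices `Sum.inl i`
and `Sum.inl (i + 1)` (cyclically) and of `k - 2` vertices `Sum.inr (i, j)` of its own. -/
def hypercycleEdge (g k : ℕ) (i : Fin g) : Set (Fin g ⊕ Fin g × Fin (k - 2)) :=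
  {Sum.inl i, Sum.inl (cyclicSucc i)} ∪ Set.range fun j => Sum.inr (i, j)

/-- The `k`-uniform hypercycle with `g` edges (used for `g ≥ 2` and `k ≥ 3`). For `g = 2` it
consists of two edges with exactly two common vertices. -/
def hypercycle (g k : ℕ) : Hypergraph (Fin g ⊕ Fin g × Fin (k - 2)) where
  vertexSet := Set.univ
  edgeSet := Set.range (hypercycleEdge g k)
  subset_vertexSet_of_mem_edgeSet' := fun _ _ => Set.subset_univ _

/-- The junction vertices `w 0, …, w s` of a hyperpath of length `s` attached at `v`: `w 0 = v`, and
`w 1, …, w s` are new vertices. -/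
def pathJunction {α : Type*} (v : α) (s k : ℕ) :
    Fin (s + 1) → α ⊕ (Fin s ⊕ Fin s × Fin (k - 2)) :=
  Fin.cons (Sum.inl v) fun t => Sum.inr (Sum.inl t)

/-- The `t`-th edge of the attached hyperpath: it consists of the junction vertices `w t` and
`w (t + 1)` and of `k - 2` vertices of its own. -/
def pathEdge {α : Type*} (v : α) (s k : ℕ) (t : Fin s) :
    Set (α ⊕ (Fin s ⊕ Fin s × Fin (k - 2))) :=
  {pathJunction v s k t.castSucc, pathJunction v s k t.succ} ∪
    Set.range fun j => Sum.inr (Sum.inr (t, j))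

/-- The hypergraph obtained from `H` by attaching at its vertex `v` a pendant hyperpath of length
`s` with edges of size `k`; all vertices of the hyperpath other than `v` are new. -/
def attachHyperpath {α : Type*} (H : Hypergraph α) (v : α) (hv : v ∈ V(H)) (s k : ℕ) :
    Hypergraph (α ⊕ (Fin s ⊕ Fin s × Fin (k - 2))) where
  vertexSet := Sum.inl '' V(H) ∪ Set.range Sum.inr
  edgeSet := Set.image Sum.inl '' E(H) ∪ Set.range (pathEdge v s k)
  subset_vertexSet_of_mem_edgeSet' := by
    rintro e (⟨e', he', rfl⟩ | ⟨t, rfl⟩)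
    · exact (Set.image_mono (H.subset_vertexSet_of_mem_edgeSet' he')).trans
        Set.subset_union_left
    · have hw : ∀ u, pathJunction v s k u ∈
          (Sum.inl '' V(H) ∪ Set.range Sum.inr : Set (α ⊕ (Fin s ⊕ Fin s × Fin (k - 2)))) := by
        intro u
        refine Fin.cases ?_ (fun i => ?_) u
        · exact Or.inl ⟨v, hv, rfl⟩
        · exact Or.inr ⟨Sum.inl i, rfl⟩
      rintro x ((rfl | rfl) | ⟨j, rfl⟩)
      · exact hw _
      · exact hw _
      · exact Or.inr ⟨_, rfl⟩

/-- The second type lollipop `Lop_{g,k,s;2}`: a pendant hyperpath of length `s` is attached to the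
hypercycle with `g` edges at a vertex of degree one (a non-junction vertex) of its first edge. -/
def lollipopTwo (g k s : ℕ) (hg : 2 ≤ g) (hk : 3 ≤ k) :
    Hypergraph ((Fin g ⊕ Fin g × Fin (k - 2)) ⊕ (Fin s ⊕ Fin s × Fin (k - 2))) :=
  (hypercycle g k).attachHyperpath
    (Sum.inr (⟨0, by omega⟩, ⟨0, by omega⟩)) (Set.mem_univ _) s k

end Hypergraph

/-! Put `r = (k - 1) ρ` and pass from vertices to edges. If `S e` is the sum of an eigenvector `x`
over the edge `e`, then `(r + d) x v` is the sum of `S e` over the `d` edges at `v`, so `x` is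
recovered from `S`. A positive solution of these equations determines `ρ`
(`maxModulus_ofIncidence_eq`). The quadratic form of `k - 1` times the adjacency matrix is a sum
over edges of `(∑ x)² - ∑ x²`, and each term is nonnegative for `x ≥ 0`. Test vectors supported on a
few edges therefore bound `ρ` from below (`sum_edgeForm_le`). The bound is strict if such a vector
vanishes at some vertex of a connected hypergraph (`IsConnected.lt_specRadius_of_vanishing`).

Structure: in a connected `k`-uniform hypergraph each further edge brings at most `k - 1` new
vertices, so in a unicyclic one every nonempty set of `f` edges covers at least `(k - 1) f`
vertices. A shortest closed nonbacktracking walk thus yields a hypercycle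
(`IsUnicyclic.exists_isCycleEmbedding`), and if this is not everything, some edge `P` meets it in
exactly one vertex (`IsUnicyclic.exists_pendant`).

Part (1): constant edge weights solve the equations of every hypercycle, with the same `r =
cycleRadius k` for all lengths. Extending that eigenvector by zero gives strict inequality for every
other unicyclic hypergraph.

Part (2): let the hypergraph have `h + 1` edges and contain a hypercycle with `g ≤ h` edges. With `c
= edgeRatio k r` and `q + 1/q = c`, the edge weights `q ^ i + q ^ (h - i)` and a suitable pendant
weight solve the equations of the lollipop over `h` edges, once `r` satisfies one scalar equation
(`exists_lollipop_parameter`). For the same `r` and `q`, the analogous vector on the hypercycle with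
`g` edges and on `P` has Rayleigh quotient at least `r`: the only defect sits at edge `0`, and its
sign follows from the monotonicity in `decay_add_le`. If `P` hangs at a junction, the larger vertex
weight there gives strictness. If it hangs at a vertex of degree one in the hypercycle, either the
test vector vanishes somewhere, again giving strictness, or the hypergraph is the lollipop. -/

namespace Matrix

/-! ### Spectral radii of symmetric matrices: Rayleigh and Collatz–Wielandt bounds. -/

variable {β γ : Type*} [Fintype β] [DecidableEq β] [Fintype γ] [DecidableEq γ]

/-- The maximum modulus of the complex eigenvalues of a real matrix. -/
noncomputable def maxModulus (M : Matrix β β ℝ) : ℝ :=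
  (spectralRadius ℂ (M.map (fun x : ℝ => (x : ℂ)))).toReal

lemma maxModulus_reindex (e : β ≃ γ) (M : Matrix β β ℝ) :
    (M.reindex e e).maxModulus = M.maxModulus := by
  have h : (M.reindex e e).map (fun x : ℝ => (x : ℂ)) =
      Matrix.reindexAlgEquiv ℂ ℂ e (M.map (fun x : ℝ => (x : ℂ))) := rfl
  rw [maxModulus, maxModulus, h, spectralRadius, spectralRadius, AlgEquiv.spectrum_eq]

open scoped Matrix.Norms.L2Operator in
/-- The Rayleigh quotient of a real symmetric matrix is at most its spectral radius. -/
lemma dotProduct_mulVec_le_maxModulus {M : Matrix β β ℝ} (hM : M.IsSymm) (x : β → ℝ) :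
    x ⬝ᵥ (M *ᵥ x) ≤ M.maxModulus * (x ⬝ᵥ x) := by
  set N : Matrix β β ℂ := M.map (fun x : ℝ => (x : ℂ)) with hN
  have hsa : IsSelfAdjoint N := by
    ext i j
    simp [hN, Matrix.star_apply, hM.apply i j]
  -- For a self-adjoint matrix the spectral radius is the operator norm, so Cauchy–Schwarz suffices.
  have hrad : M.maxModulus = ‖N‖ := by
    rw [maxModulus, ← hN, hsa.spectralRadius_eq_nnnorm]
    simp
  set v : EuclideanSpace ℂ β := WithLp.toLp 2 (fun i => (x i : ℂ)) with hv
  have h1 := Matrix.l2_opNorm_mulVec N v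
  have h2 := norm_inner_le_norm (𝕜 := ℂ) v (WithLp.toLp 2 (N *ᵥ WithLp.ofLp v))
  have h3 : inner ℂ v (WithLp.toLp 2 (N *ᵥ WithLp.ofLp v)) = ((x ⬝ᵥ (M *ᵥ x) : ℝ) : ℂ) := by
    simp [PiLp.inner_apply, hv, hN, dotProduct, mulVec, mul_comm]
  have h4 : ‖v‖ * ‖v‖ = x ⬝ᵥ x := by
    rw [← pow_two, EuclideanSpace.norm_sq_eq]
    simp [hv, dotProduct, pow_two]
  rw [h3, Complex.norm_real] at h2
  calc x ⬝ᵥ (M *ᵥ x) ≤ ‖v‖ * (‖N‖ * ‖v‖) := (le_abs_self _).trans (h2.trans (by gcongr; exact h1))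
    _ = M.maxModulus * (x ⬝ᵥ x) := by rw [hrad, ← h4]; ring

/-- A nonnegative symmetric matrix with a positive vector `x` such that `M x ≤ l x` has spectral
radius at most `l`. -/
lemma maxModulus_le {M : Matrix β β ℝ} (hM : M.IsSymm) (h0 : ∀ i j, 0 ≤ M i j) {x : β → ℝ}
    (hx : ∀ i, 0 < x i) {l : ℝ} (hl : 0 ≤ l) (h : ∀ i, (M *ᵥ x) i ≤ l * x i) :
    M.maxModulus ≤ l := by
  rw [maxModulus]
  refine ENNReal.toReal_le_of_le_ofReal hl (iSup₂_le fun μ hμ => ?_)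
  rw [← Matrix.spectrum_toLin', ← Module.End.hasEigenvalue_iff_mem_spectrum] at hμ
  obtain ⟨v, hv⟩ := hμ.exists_hasEigenvector
  have hv1 := hv.apply_eq_smul
  have hv0 := hv.2
  rw [Matrix.toLin'_apply] at hv1
  have hle : ∀ i, ‖μ‖ * ‖v i‖ ≤ ∑ j, M i j * ‖v j‖ := fun i => by
    have := congrFun hv1 i
    simp only [mulVec, dotProduct, Matrix.map_apply, Pi.smul_apply, smul_eq_mul] at this
    rw [← norm_mul, ← this]
    refine (norm_sum_le _ _).trans (le_of_eq (Finset.sum_congr rfl fun j _ => ?_))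
    rw [norm_mul, Complex.norm_real, Real.norm_of_nonneg (h0 i j)]
  have hpos : 0 < ∑ i, x i * ‖v i‖ := by
    obtain ⟨i, hi⟩ := Function.ne_iff.1 hv0
    exact Finset.sum_pos' (fun j _ => mul_nonneg (hx j).le (norm_nonneg _))
      ⟨i, Finset.mem_univ _, mul_pos (hx i) (norm_pos_iff.2 hi)⟩
  -- Pair `|μ| |v| ≤ M |v|` with the positive vector `x` and move `M` onto `x` by symmetry.
  have key : ‖μ‖ * ∑ i, x i * ‖v i‖ ≤ l * ∑ i, x i * ‖v i‖ := by
    calc ‖μ‖ * ∑ i, x i * ‖v i‖ = ∑ i, x i * (‖μ‖ * ‖v i‖) := by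
          rw [Finset.mul_sum]; exact Finset.sum_congr rfl fun i _ => by ring
      _ ≤ ∑ i, x i * ∑ j, M i j * ‖v j‖ :=
          Finset.sum_le_sum fun i _ => mul_le_mul_of_nonneg_left (hle i) (hx i).le
      _ = ∑ j, ‖v j‖ * (M *ᵥ x) j := by
          simp only [mulVec, dotProduct, Finset.mul_sum]
          rw [Finset.sum_comm]
          refine Finset.sum_congr rfl fun j _ => Finset.sum_congr rfl fun i _ => ?_
          rw [hM.apply i j]; ring
      _ ≤ ∑ j, ‖v j‖ * (l * x j) :=
          Finset.sum_le_sum fun i _ => mul_le_mul_of_nonneg_left (h i) (norm_nonneg _)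
      _ = l * ∑ i, x i * ‖v i‖ := by
          rw [Finset.mul_sum]; exact Finset.sum_congr rfl fun i _ => by ring
  have hfin := le_of_mul_le_mul_right key hpos
  rw [← ENNReal.ofReal_coe_nnreal, coe_nnnorm]
  exact ENNReal.ofReal_le_ofReal hfin

/-! ### Weighted adjacency matrices of incidence relations. -/

open Classical in
/-- The weighted adjacency matrix of an incidence relation: `a ≠ b` contribute `1 / (k - 1)` for
every common incident element of `ι`. -/
noncomputable def ofIncidence {ι : Type*} [Fintype ι] (k : ℕ) (R : β → ι → Prop) :
    Matrix β β ℝ :=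
  Matrix.of fun a b => if a = b then 0 else ∑ i, if R a i ∧ R b i then 1 / ((k : ℝ) - 1) else 0

lemma ofIncidence_isSymm {β ι : Type*} [DecidableEq β] [Fintype ι] {k : ℕ} {R : β → ι → Prop} :
    (ofIncidence k R).IsSymm := by
  ext a b
  simp only [ofIncidence, Matrix.transpose_apply, Matrix.of_apply, eq_comm (a := b)]
  congr 1
  exact Finset.sum_congr rfl fun i _ => by split_ifs <;> tauto

lemma ofIncidence_nonneg {β ι : Type*} [DecidableEq β] [Fintype ι] {k : ℕ} {R : β → ι → Prop}
    (hk : 2 ≤ k) (a b : β) : 0 ≤ ofIncidence k R a b := by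
  have : (2 : ℝ) ≤ k := by exact_mod_cast hk
  simp only [ofIncidence, Matrix.of_apply]
  split_ifs
  · exact le_rfl
  · refine Finset.sum_nonneg fun i _ => ?_
    split_ifs
    · exact div_nonneg zero_le_one (by linarith)
    · exact le_rfl

section Incidence

variable {ι : Type*} [Fintype ι] {k : ℕ} {R : β → ι → Prop}

open Classical in
-- The factor `k - 1` clears the entry weights; the zero diagonal then removes `x a` once from the
-- total of each edge through `a`. This is what turns the eigenvector equation into one about edge
-- sums.
lemma ofIncidence_mulVec (hk : 2 ≤ k) (x : β → ℝ) (a : β) :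
    ((k : ℝ) - 1) * (ofIncidence k R *ᵥ x) a =
      ∑ i, if R a i then (∑ b, if R b i then x b else 0) - x a else 0 := by
  have hk' : ((k : ℝ) - 1) ≠ 0 := by
    have : (2 : ℝ) ≤ k := by exact_mod_cast hk
    linarith
  have h1 : ∀ i, (if R a i then (∑ b, if R b i then x b else 0) - x a else 0) =
      ∑ b, if R a i ∧ R b i ∧ a ≠ b then x b else 0 := fun i => by
    split_ifs with h
    · rw [← Finset.add_sum_erase Finset.univ (fun b => if R b i then x b else 0)
          (Finset.mem_univ a), ← Finset.add_sum_erase Finset.univ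
          (fun b => if R a i ∧ R b i ∧ a ≠ b then x b else 0) (Finset.mem_univ a)]
      simp only [h, if_true, true_and, ne_eq, not_true, and_false, if_false, zero_add,
        add_sub_cancel_left]
      refine Finset.sum_congr rfl fun b hb => ?_
      simp [(Finset.ne_of_mem_erase hb).symm]
    · simp [h]
  simp only [h1]
  rw [Finset.sum_comm, mulVec, dotProduct, Finset.mul_sum]
  refine Finset.sum_congr rfl fun b _ => ?_
  by_cases hab : a = b
  · simp [ofIncidence, hab]
  · simp only [ofIncidence, of_apply, hab, if_false, ne_eq, not_false_eq_true, and_true]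
    rw [Finset.sum_mul, Finset.mul_sum]
    refine Finset.sum_congr rfl fun i _ => ?_
    split_ifs
    · field_simp
    · simp

open Classical in
/-- Edge form of the eigenvector equation: positive weights `S` on the edges which are the edge
sums of the vertex weights they induce. -/
lemma maxModulus_ofIncidence_eq [Nonempty β] (hk : 2 ≤ k) {x : β → ℝ} (hx : ∀ b, 0 < x b)
    {S : ι → ℝ} {r : ℝ} (hr : 0 ≤ r)
    (h1 : ∀ b, r * x b = ∑ i, if R b i then S i - x b else 0)
    (h2 : ∀ i, (∑ b, if R b i then x b else 0) = S i) :
    (ofIncidence k R).maxModulus = r / ((k : ℝ) - 1) := by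
  have hk' : 0 < ((k : ℝ) - 1) := by
    have : (2 : ℝ) ≤ k := by exact_mod_cast hk
    linarith
  have heig : ∀ b, (ofIncidence k R *ᵥ x) b = r / ((k : ℝ) - 1) * x b := fun b => by
    have h := ofIncidence_mulVec (R := R) hk x b
    simp only [h2] at h
    rw [← h1] at h
    field_simp
    linarith
  -- A positive eigenvector makes the upper bound and the Rayleigh bound coincide.
  refine le_antisymm (maxModulus_le ofIncidence_isSymm (ofIncidence_nonneg hk) hx
    (by positivity) fun b => (heig b).le) ?_
  have h := dotProduct_mulVec_le_maxModulus (ofIncidence_isSymm (k := k) (R := R)) x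
  have h3 : x ⬝ᵥ (ofIncidence k R *ᵥ x) = r / ((k : ℝ) - 1) * (x ⬝ᵥ x) := by
    simp only [dotProduct, heig, Finset.mul_sum]
    exact Finset.sum_congr rfl fun b _ => by ring
  rw [h3] at h
  refine le_of_mul_le_mul_right h ?_
  exact Finset.sum_pos (fun b _ => mul_pos (hx b) (hx b)) Finset.univ_nonempty

open Classical in
lemma dotProduct_ofIncidence_mulVec (hk : 2 ≤ k) (x : β → ℝ) :
    ((k : ℝ) - 1) * (x ⬝ᵥ (ofIncidence k R *ᵥ x)) =
      ∑ i, ((∑ b, if R b i then x b else 0) ^ 2 - ∑ b, if R b i then x b ^ 2 else 0) := by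
  have h : ((k : ℝ) - 1) * (x ⬝ᵥ (ofIncidence k R *ᵥ x)) =
      ∑ a, x a * (((k : ℝ) - 1) * (ofIncidence k R *ᵥ x) a) := by
    simp only [dotProduct, Finset.mul_sum]
    exact Finset.sum_congr rfl fun b _ => by ring
  rw [h]
  simp only [ofIncidence_mulVec hk, Finset.mul_sum]
  rw [Finset.sum_comm]
  refine Finset.sum_congr rfl fun i _ => ?_
  rw [pow_two, Finset.sum_mul, ← Finset.sum_sub_distrib]
  refine Finset.sum_congr rfl fun a _ => ?_
  split_ifs <;> ring

end Incidence

end Matrix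

namespace Hypergraph

/-! ### The spectral radius of a hypergraph through its edge forms. -/

section Realization

variable {α : Type*} {G : Hypergraph α} {k : ℕ}

lemma IsUniform.nonempty_of_mem (hu : G.IsUniform k) (hk : 1 ≤ k) {e : Set α} (he : e ∈ E(G)) :
    e.Nonempty :=
  Set.nonempty_of_ncard_ne_zero (by rw [hu e he]; omega)

lemma finite_of_mem_edgeSet [Finite V(G)] {e : Set α} (he : e ∈ E(G)) : e.Finite :=
  (Set.toFinite V(G)).subset he.subset_vertexSet

lemma finite_edgeSet [Finite V(G)] : E(G).Finite :=
  (Set.toFinite V(G)).finite_subsets.subset fun _ he => he.subset_vertexSet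

/-- The spectral radius computed from any labelling of the vertices and of the edges. -/
theorem specRadius_eq_maxModulus {β ι : Type*} [Fintype β] [DecidableEq β] [Fintype ι]
    [Finite V(G)] (hu : G.IsUniform k) {f : β → α} (hf : f.Injective)
    (hfr : Set.range f = V(G)) {e : ι → Set α} (he : e.Injective) (her : Set.range e = E(G)) :
    G.specRadius = (Matrix.ofIncidence k fun b i => f b ∈ e i).maxModulus := by
  classical
  let _ : Fintype V(G) := Fintype.ofFinite V(G)
  let q : β ≃ V(G) := (Equiv.ofInjective f hf).trans (Equiv.setCongr hfr)
  have hq : ∀ b, (q b : α) = f b := fun b => rfl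
  have h : G.adjMatrix = (Matrix.ofIncidence k fun b i => f b ∈ e i).reindex q q := by
    ext u v
    obtain ⟨a, rfl⟩ := q.surjective u
    obtain ⟨b, rfl⟩ := q.surjective v
    simp only [adjMatrix, Matrix.ofIncidence, Matrix.reindex_apply, Matrix.submatrix_apply,
      Matrix.of_apply, Equiv.symm_apply_apply, q.injective.eq_iff]
    by_cases hab : a = b
    · simp [hab]
    simp only [hab, if_false]
    have hset : {s : Set α | s ∈ E(G) ∧ (q a : α) ∈ s ∧ (q b : α) ∈ s} =
        e '' {i | f a ∈ e i ∧ f b ∈ e i} := by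
      ext s
      simp only [hq, ← her]
      constructor
      · rintro ⟨⟨i, rfl⟩, h⟩
        exact ⟨i, h, rfl⟩
      · rintro ⟨i, h, rfl⟩
        exact ⟨⟨i, rfl⟩, h⟩
    rw [hset, finsum_mem_image he.injOn, finsum_mem_eq_finite_toFinset_sum _ (Set.toFinite _),
      ← Finset.sum_filter]
    refine Finset.sum_congr (by ext; simp) fun i _ => ?_
    rw [hu _ (her ▸ Set.mem_range_self i)]
  rw [← Matrix.maxModulus_reindex q, ← h, specRadius, Matrix.maxModulus]

/-- The vertices and edges of `G` label those of both hypergraphs, with the same incidence relation.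
-/
theorem IsIsomorphic.specRadius_eq {β : Type*} {K : Hypergraph β} [Finite V(G)] [Finite V(K)]
    (hG : G.IsUniform k) (hK : K.IsUniform k) (h : G.IsIsomorphic K) :
    G.specRadius = K.specRadius := by
  classical
  obtain ⟨f, hV, hE⟩ := h
  let _ : Fintype V(G) := Fintype.ofFinite V(G)
  have : Finite E(G) := finite_edgeSet
  let _ : Fintype E(G) := Fintype.ofFinite E(G)
  rw [specRadius_eq_maxModulus hG (f := ((↑) : V(G) → α)) Subtype.coe_injective Subtype.range_coe
      (e := ((↑) : E(G) → Set α)) Subtype.coe_injective Subtype.range_coe,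
    specRadius_eq_maxModulus hK (f := fun v : V(G) => f v) hV.injOn.injective
      (by rw [← hV.image_eq, Set.image_eq_range]) (e := fun s : E(G) => f '' s) hE.injOn.injective
      (by rw [← hE.image_eq, Set.image_eq_range])]
  congr 2
  ext v s
  exact (hV.injOn.mem_image_iff s.2.subset_vertexSet v.2).symm

/-- The contribution of an edge to the quadratic form of `k - 1` times the adjacency matrix. -/
noncomputable def edgeForm (x : α → ℝ) (e : Set α) : ℝ :=
  (∑ᶠ v ∈ e, x v) ^ 2 - ∑ᶠ v ∈ e, x v ^ 2

lemma edgeForm_nonneg {x : α → ℝ} (hx : ∀ v, 0 ≤ x v) {e : Set α} (he : e.Finite) :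
    0 ≤ edgeForm x e := by
  rw [edgeForm, finsum_mem_eq_finite_toFinset_sum _ he, finsum_mem_eq_finite_toFinset_sum _ he,
    sub_nonneg]
  exact Finset.sum_sq_le_sq_sum_of_nonneg fun v _ => hx v

lemma finsum_mem_eq_sum_subtype {β : Type*} {s t : Set β} [Fintype t] [DecidablePred (· ∈ s)]
    (hst : s ⊆ t) (x : β → ℝ) : ∑ᶠ v ∈ s, x v = ∑ v : t, if (v : β) ∈ s then x v else 0 := by
  rw [← finsum_eq_sum_of_fintype,
    finsum_set_coe_eq_finsum_mem (f := fun v => if v ∈ s then x v else 0)]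
  refine finsum_congr fun v => ?_
  by_cases hs : v ∈ s
  · simp [hs, hst hs]
  · simp [hs]

/-- The Rayleigh inequality written as a sum over edges, so that edges can be discarded from lower
bounds. -/
theorem sum_edgeForm_le [Finite V(G)] (hk : 2 ≤ k) (hu : G.IsUniform k) (x : α → ℝ) :
    ∑ᶠ e ∈ E(G), edgeForm x e ≤ ((k : ℝ) - 1) * G.specRadius * ∑ᶠ v ∈ V(G), x v ^ 2 := by
  classical
  let _ : Fintype V(G) := Fintype.ofFinite V(G)
  have : Finite E(G) := finite_edgeSet
  let _ : Fintype E(G) := Fintype.ofFinite E(G)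
  have hk' : (0 : ℝ) ≤ (k : ℝ) - 1 := by
    have : (2 : ℝ) ≤ k := by exact_mod_cast hk
    linarith
  rw [specRadius_eq_maxModulus hu (f := ((↑) : V(G) → α)) Subtype.coe_injective Subtype.range_coe
      (e := ((↑) : E(G) → Set α)) Subtype.coe_injective Subtype.range_coe]
  set M := Matrix.ofIncidence k fun (b : V(G)) (i : E(G)) => (b : α) ∈ (i : Set α) with hM
  have h := Matrix.dotProduct_mulVec_le_maxModulus (M := M) Matrix.ofIncidence_isSymm
    fun v => x v
  have h2 := Matrix.dotProduct_ofIncidence_mulVec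
    (R := fun (b : V(G)) (i : E(G)) => (b : α) ∈ (i : Set α)) hk fun v => x v
  have h3 : ∑ᶠ e ∈ E(G), edgeForm x e =
      ((k : ℝ) - 1) * ((fun v : V(G) => x v) ⬝ᵥ (M.mulVec fun v : V(G) => x v)) := by
    rw [hM, h2, finsum_mem_eq_sum_subtype subset_rfl]
    refine Finset.sum_congr rfl fun i _ => ?_
    rw [if_pos i.2, edgeForm, finsum_mem_eq_sum_subtype i.2.subset_vertexSet,
      finsum_mem_eq_sum_subtype i.2.subset_vertexSet]
  have h4 : ∑ᶠ v ∈ V(G), x v ^ 2 = (fun v : V(G) => x v) ⬝ᵥ (fun v : V(G) => x v) := by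
    rw [finsum_mem_eq_sum_subtype subset_rfl]
    refine Finset.sum_congr rfl fun i _ => ?_
    rw [if_pos i.2, pow_two]
  rw [h3, h4, mul_assoc]
  exact mul_le_mul_of_nonneg_left h hk'

/-- In a connected hypergraph, any set of vertices that is neither empty nor everything is crossed
by an edge. -/
lemma IsConnected.exists_edge_crossing (hc : G.IsConnected) {W : Set α} {w v : α} (hw : w ∈ W)
    (hwV : w ∈ V(G)) (hv : v ∉ W) (hvV : v ∈ V(G)) :
    ∃ e ∈ E(G), ∃ a ∈ e, ∃ b ∈ e, a ∈ W ∧ b ∉ W := by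
  by_contra! hcon
  refine hv ?_
  have h := hc.2 w hwV v hvV
  clear hv hvV
  induction h with
  | refl => exact hw
  | tail _ hbc ih =>
    obtain ⟨e, he, hb, hc⟩ := hbc
    exact hcon e he _ hb _ hc ih

lemma finsum_mem_nonneg {β : Type*} {s : Set β} {x : β → ℝ} (hx : ∀ v, 0 ≤ x v) :
    0 ≤ ∑ᶠ v ∈ s, x v :=
  finsum_nonneg fun v => finsum_nonneg fun _ => hx v

lemma finsum_mem_single {s : Set α} (hs : s.Finite) (v : α) (δ : ℝ) [DecidableEq α]
    [Decidable (v ∈ s)] :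
    ∑ᶠ a ∈ s, (Pi.single v δ : α → ℝ) a = if v ∈ s then δ else 0 := by
  rw [finsum_mem_eq_finite_toFinset_sum _ hs, Finset.sum_pi_single']
  simp

/-- A nonnegative test vector with Rayleigh quotient at least `r` and with zero and nonzero entries
shows that the spectral radius of a connected hypergraph is greater than `r / (k - 1)`. -/
theorem IsConnected.lt_specRadius_of_vanishing [Finite V(G)] (hc : G.IsConnected) (hk : 2 ≤ k)
    (hu : G.IsUniform k) {x : α → ℝ} (hx : ∀ v, 0 ≤ x v) {r : ℝ} (hr : 0 < r)
    (hform : r * ∑ᶠ v ∈ V(G), x v ^ 2 ≤ ∑ᶠ e ∈ E(G), edgeForm x e)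
    {w : α} (hwV : w ∈ V(G)) (hw : 0 < x w) {v : α} (hvV : v ∈ V(G)) (hv : x v = 0) :
    r < ((k : ℝ) - 1) * G.specRadius := by
  classical
  obtain ⟨e₀, he₀, a, ha, b, hb, haW, hbW⟩ :=
    hc.exists_edge_crossing (W := {a | 0 < x a}) hw hwV (by simp [hv]) hvV
  have haW : 0 < x a := haW
  have hbW : x b = 0 := le_antisymm (not_lt.1 hbW) (hx b)
  by_contra! hle
  -- Raising the zero entry at `b` to `δ` lowers no edge form and gains at least `2 δ x a` on `e₀`,
  -- at a cost of at most `r δ²`. For `δ = x a / r` the gain is `2 r δ²`, which contradicts `hle`.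
  set δ : ℝ := x a / r with hδ
  have hδ0 : 0 < δ := div_pos haW hr
  set y : α → ℝ := fun c => x c + (Pi.single b δ : α → ℝ) c with hy
  have hysq : ∀ c, y c ^ 2 = x c ^ 2 + (Pi.single b (δ ^ 2) : α → ℝ) c := fun c => by
    by_cases hcb : c = b
    · subst hcb; simp [hy, hbW]
    · simp [hy, hcb]
  have hsum : ∀ s : Set α, s.Finite →
      ∑ᶠ c ∈ s, y c = ∑ᶠ c ∈ s, x c + if b ∈ s then δ else 0 := fun s hs => by
    rw [finsum_mem_add_distrib hs, finsum_mem_single hs]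
  have hsumsq : ∀ s : Set α, s.Finite →
      ∑ᶠ c ∈ s, y c ^ 2 = ∑ᶠ c ∈ s, x c ^ 2 + if b ∈ s then δ ^ 2 else 0 := fun s hs => by
    simp only [hysq]
    rw [finsum_mem_add_distrib hs, finsum_mem_single hs]
  have hx0 : ∀ s : Set α, 0 ≤ ∑ᶠ c ∈ s, x c := fun s => finsum_mem_nonneg fun c => hx c
  have hE : E(G).Finite := finite_edgeSet
  have hle_edge : ∀ e ∈ E(G), edgeForm x e ≤ edgeForm y e := fun e he => by
    have hfe := finite_of_mem_edgeSet he
    rw [edgeForm, edgeForm, hsum e hfe, hsumsq e hfe]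
    have := hx0 e
    split_ifs
    · nlinarith
    · simp
  have hedge₀ : edgeForm x e₀ + 2 * δ * x a ≤ edgeForm y e₀ := by
    have hfe := finite_of_mem_edgeSet he₀
    rw [edgeForm, edgeForm, hsum _ hfe, hsumsq _ hfe, if_pos hb, if_pos hb]
    have : x a ≤ ∑ᶠ c ∈ e₀, x c := by
      rw [finsum_mem_eq_finite_toFinset_sum _ hfe]
      exact Finset.single_le_sum (f := x) (fun c _ => hx c) (by simpa using ha)
    nlinarith
  have htot : ∑ᶠ e ∈ E(G), edgeForm x e + 2 * δ * x a ≤ ∑ᶠ e ∈ E(G), edgeForm y e := by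
    rw [finsum_mem_eq_finite_toFinset_sum _ hE, finsum_mem_eq_finite_toFinset_sum _ hE,
      ← Finset.add_sum_erase _ _ (hE.mem_toFinset.2 he₀),
      ← Finset.add_sum_erase _ _ (hE.mem_toFinset.2 he₀)]
    have := Finset.sum_le_sum (s := hE.toFinset.erase e₀) (f := edgeForm x) (g := edgeForm y)
      fun e he => hle_edge e (hE.mem_toFinset.1 (Finset.mem_of_mem_erase he))
    linarith
  have hray := sum_edgeForm_le hk hu y
  rw [hsumsq _ (Set.toFinite _), if_pos (he₀.subset_vertexSet hb)] at hray
  have hN : 0 ≤ ∑ᶠ c ∈ V(G), x c ^ 2 := finsum_mem_nonneg fun c => sq_nonneg _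
  have h1 : ((k : ℝ) - 1) * G.specRadius * (∑ᶠ c ∈ V(G), x c ^ 2 + δ ^ 2) ≤
      r * (∑ᶠ c ∈ V(G), x c ^ 2 + δ ^ 2) :=
    mul_le_mul_of_nonneg_right hle (by positivity)
  have h2 : x a = r * δ := by rw [hδ]; field_simp
  rw [h2] at htot
  nlinarith [mul_pos hr (mul_pos hδ0 hδ0)]

end Realization

end Hypergraph

namespace Hypergraph

/-! ### Unicyclic hypergraphs contain hypercycles. -/

section Cycle

variable {α : Type*} {G : Hypergraph α} {k : ℕ}

lemma IsConnected.exists_edge_meeting (hc : G.IsConnected) (hk : 1 ≤ k) (hu : G.IsUniform k)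
    {F : Set (Set α)} (hF : F ⊆ E(G)) (hne : F.Nonempty) (hFE : F ≠ E(G)) :
    ∃ P ∈ E(G), P ∉ F ∧ (P ∩ ⋃₀ F).Nonempty := by
  by_cases hV : V(G) ⊆ ⋃₀ F
  · obtain ⟨P, hP, hPF⟩ := Set.exists_of_ssubset (hF.ssubset_of_ne hFE)
    obtain ⟨a, ha⟩ := hu.nonempty_of_mem hk hP
    exact ⟨P, hP, hPF, a, ha, hV (hP.subset_vertexSet ha)⟩
  · obtain ⟨v, hvV, hv⟩ := Set.not_subset.1 hV
    obtain ⟨f, hf⟩ := hne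
    obtain ⟨w, hw⟩ := hu.nonempty_of_mem hk (hF hf)
    obtain ⟨P, hP, a, ha, b, hb, haF, hbF⟩ := hc.exists_edge_crossing (W := ⋃₀ F) ⟨f, hf, hw⟩
      ((hF hf).subset_vertexSet hw) hv hvV
    exact ⟨P, hP, fun h => hbF ⟨P, h, hb⟩, a, ha, haF⟩

lemma IsConnected.sUnion_edgeSet (hc : G.IsConnected) (hk : 1 ≤ k) (hu : G.IsUniform k)
    (hne : E(G).Nonempty) : ⋃₀ E(G) = V(G) := by
  refine sUnion_edgeSet_subset_vertexSet.antisymm fun v hvV => ?_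
  by_contra hv
  obtain ⟨f, hf⟩ := hne
  obtain ⟨w, hw⟩ := hu.nonempty_of_mem hk hf
  obtain ⟨P, hP, a, ha, b, hb, haF, hbF⟩ := hc.exists_edge_crossing (W := ⋃₀ E(G)) ⟨f, hf, hw⟩
    (hf.subset_vertexSet hw) hv hvV
  exact hbF ⟨P, hP, hb⟩

lemma finite_sUnion_of_subset [Finite V(G)] {F : Set (Set α)} (hF : F ⊆ E(G)) :
    (⋃₀ F).Finite :=
  (Set.toFinite V(G)).subset ((Set.sUnion_mono hF).trans sUnion_edgeSet_subset_vertexSet)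

/-- Growing a set of edges of a connected uniform hypergraph one edge at a time. -/
lemma IsConnected.ncard_le [Finite V(G)] (hc : G.IsConnected) (hk : 1 ≤ k) (hu : G.IsUniform k)
    {F : Set (Set α)} (hF : F ⊆ E(G)) (hne : F.Nonempty) :
    V(G).ncard + (k - 1) * F.ncard ≤ (⋃₀ F).ncard + (k - 1) * E(G).ncard := by
  have hE : E(G).Finite := finite_edgeSet
  induction hd : (E(G) \ F).ncard generalizing F with
  | zero =>
    rw [Set.ncard_eq_zero (hE.subset Set.sdiff_subset), Set.sdiff_eq_empty] at hd
    rw [hF.antisymm hd] at hne ⊢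
    rw [hc.sUnion_edgeSet hk hu hne]
  | succ d ih =>
    have hFE : F ≠ E(G) := by
      rintro rfl
      simp at hd
    obtain ⟨P, hP, hPF, hPm⟩ := hc.exists_edge_meeting hk hu hF hne hFE
    have h1 : (E(G) \ insert P F).ncard = d := by
      have : E(G) \ F = insert P (E(G) \ insert P F) := by
        ext e
        by_cases heP : e = P
        · subst heP; simp [hP, hPF]
        · simp [heP]
      rw [this, Set.ncard_insert_of_notMem (by simp) (hE.subset Set.sdiff_subset)] at hd
      omega
    have h2 := ih (Set.insert_subset hP hF) (Set.insert_nonempty _ _) h1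
    rw [Set.ncard_insert_of_notMem hPF (hE.subset hF), Set.sUnion_insert] at h2
    have hPf := finite_of_mem_edgeSet hP
    -- `P` already meets the covered set, so it adds at most `k - 1` vertices.
    have h3 := Set.ncard_union_add_ncard_inter P (⋃₀ F) hPf (finite_sUnion_of_subset hF)
    have h4 : 0 < (P ∩ ⋃₀ F).ncard := (Set.ncard_pos (hPf.inter_of_left _)).2 hPm
    rw [hu P hP] at h3
    have h5 : (k - 1) * (F.ncard + 1) = (k - 1) * F.ncard + (k - 1) := by ring
    omega

lemma IsUnicyclic.ncard_eq (hG : G.IsUnicyclic k) (hk : 1 ≤ k) :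
    V(G).ncard = (k - 1) * E(G).ncard := by
  have := hG.count
  zify [hk]
  linarith

lemma IsUnicyclic.edgeSet_nonempty (hG : G.IsUnicyclic k) (hk : 1 ≤ k) : E(G).Nonempty := by
  have := hG.finite.to_subtype
  have h1 : 0 < V(G).ncard := (Set.ncard_pos hG.finite).2 hG.connected.1
  rw [hG.ncard_eq hk] at h1
  exact Set.nonempty_of_ncard_ne_zero (Nat.pos_of_mul_pos_left h1).ne'

/-- Growing `F` to all edges cannot increase covered vertices minus `(k - 1)` times the number of
edges, and for all edges this difference is zero. All rigidity of the cycle comes from this count.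
-/
lemma IsUnicyclic.le_ncard_sUnion (hG : G.IsUnicyclic k) (hk : 1 ≤ k) {F : Set (Set α)}
    (hF : F ⊆ E(G)) (hne : F.Nonempty) : (k - 1) * F.ncard ≤ (⋃₀ F).ncard := by
  have := hG.finite.to_subtype
  have := hG.connected.ncard_le hk hG.uniform hF hne
  rw [hG.ncard_eq hk] at this
  omega

/-- The edges of a unicyclic hypergraph contain a nonempty set of
edges each of which meets the others in at least two vertices. -/
lemma IsUnicyclic.exists_core (hG : G.IsUnicyclic k) (hk : 1 ≤ k) :
    ∃ F ⊆ E(G), F.Nonempty ∧ ∀ e ∈ F, ∀ v ∈ e, ∃ v' ∈ e, v ≠ v' ∧ ∃ e' ∈ F, e ≠ e' ∧ v' ∈ e' := by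
  have := hG.finite.to_subtype
  have hE : E(G).Finite := finite_edgeSet
  let s : Set (Set (Set α)) :=
    {F | F ⊆ E(G) ∧ F.Nonempty ∧ (⋃₀ F).ncard ≤ (k - 1) * F.ncard}
  have hs : s.Nonempty := ⟨E(G), subset_rfl, hG.edgeSet_nonempty hk, by
    rw [hG.connected.sUnion_edgeSet hk hG.uniform (hG.edgeSet_nonempty hk), hG.ncard_eq hk]⟩
  -- A set with as few edges as possible among those covering at most `k - 1` vertices per edge. If
  -- some edge `e` shared at most the vertex `v` with the others, deleting it would lose `k - 1`
  -- vertices and preserve the inequality.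
  obtain ⟨F, ⟨hF, hne, hcard⟩, hmin⟩ := (measure (Set.ncard (α := Set α))).wf.has_min s hs
  refine ⟨F, hF, hne, fun e he v hv => ?_⟩
  by_contra! hcon
  have hins : insert e (F \ {e}) = F := by simp [Set.insert_eq_of_mem he]
  have hF1 : F.ncard = (F \ {e}).ncard + 1 := by
    rw [← Set.ncard_insert_of_notMem (a := e) (by simp) ((hE.subset hF).subset Set.sdiff_subset),
      hins]
  have hef := finite_of_mem_edgeSet (hF he)
  have hev : (e \ {v}).ncard = k - 1 := by
    rw [Set.ncard_sdiff_singleton_of_mem hv, hG.uniform e (hF he)]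
  have hsub : ⋃₀ (F \ {e}) ∪ (e \ {v}) ⊆ ⋃₀ F :=
    Set.union_subset (Set.sUnion_mono Set.sdiff_subset)
      (Set.sdiff_subset.trans (Set.subset_sUnion_of_mem he))
  have hdisj : Disjoint (⋃₀ (F \ {e})) (e \ {v}) := by
    rw [Set.disjoint_left]
    rintro a ⟨e', ⟨he', hne'⟩, ha⟩ ⟨hae, hav⟩
    exact hcon a hae (fun h => hav h.symm) e' he' (fun h => hne' h.symm) ha
  have hle := Set.ncard_le_ncard hsub (finite_sUnion_of_subset hF)
  rw [Set.ncard_union_eq hdisj (finite_sUnion_of_subset (Set.sdiff_subset.trans hF))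
    (hef.subset Set.sdiff_subset), hev] at hle
  have h5 : (k - 1) * ((F \ {e}).ncard + 1) = (k - 1) * (F \ {e}).ncard + (k - 1) := by ring
  rw [hF1, h5] at hcard
  by_cases hF' : (F \ {e}).Nonempty
  · refine hmin (F \ {e}) ⟨Set.sdiff_subset.trans hF, hF', by omega⟩ ?_
    change (F \ {e}).ncard < F.ncard
    omega
  -- A single edge covers `k > k - 1` vertices, so it is not in the family.
  · rw [Set.not_nonempty_iff_eq_empty] at hF'
    rw [hF'] at hins hcard
    rw [← hins] at hcard
    simp [hG.uniform e (hF he)] at hcard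
    omega

/-- The core property lets a pair of a vertex and an edge through it be continued with both entries
changed; iterating a choice of continuation gives the walk. -/
lemma exists_nonbacktracking_walk {F : Set (Set α)} {e₀ : Set α} {v₀ : α} (he₀ : e₀ ∈ F)
    (hv₀ : v₀ ∈ e₀)
    (hF : ∀ e ∈ F, ∀ v ∈ e, ∃ v' ∈ e, v ≠ v' ∧ ∃ e' ∈ F, e ≠ e' ∧ v' ∈ e') :
    ∃ (v : ℕ → α) (e : ℕ → Set α), ∀ i, e i ∈ F ∧ v i ∈ e i ∧ v (i + 1) ∈ e i ∧ v i ≠ v (i + 1) ∧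
      e i ≠ e (i + 1) := by
  have hstep : ∀ p : {p : α × Set α // p.2 ∈ F ∧ p.1 ∈ p.2},
      ∃ p' : {p : α × Set α // p.2 ∈ F ∧ p.1 ∈ p.2},
        p'.1.1 ∈ p.1.2 ∧ p.1.1 ≠ p'.1.1 ∧ p.1.2 ≠ p'.1.2 := by
    rintro ⟨⟨v, e⟩, he, hv⟩
    obtain ⟨v', hv', hne, e', he', hee, hve⟩ := hF e he v hv
    exact ⟨⟨⟨v', e'⟩, he', hve⟩, hv', hne, hee⟩
  choose step hstep using hstep
  let p : ℕ → {p : α × Set α // p.2 ∈ F ∧ p.1 ∈ p.2} := fun i => step^[i] ⟨⟨v₀, e₀⟩, he₀, hv₀⟩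
  have hp : ∀ i, p (i + 1) = step (p i) := fun i => Function.iterate_succ_apply' _ _ _
  refine ⟨fun i => (p i).1.1, fun i => (p i).1.2, fun i => ⟨(p i).2.1, (p i).2.2, ?_⟩⟩
  simp only [hp]
  exact hstep (p i)

/-- A nonbacktracking walk through finitely many edges contains a closed walk with distinct
edges. -/
lemma exists_closed_walk {F : Set (Set α)} (hfin : F.Finite) {v : ℕ → α} {e : ℕ → Set α}
    (h : ∀ i, e i ∈ F ∧ v i ∈ e i ∧ v (i + 1) ∈ e i ∧ v i ≠ v (i + 1) ∧ e i ≠ e (i + 1)) :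
    ∃ (g : ℕ) (u : ℕ → α) (c : ℕ → Set α), 2 ≤ g ∧ u g = u 0 ∧ Set.InjOn c (Set.Iio g) ∧
      ∀ i < g, c i ∈ F ∧ u i ∈ c i ∧ u (i + 1) ∈ c i ∧ u i ≠ u (i + 1) := by
  classical
  have hex : ∃ d, 0 < d ∧ ∃ i, e i = e (i + d) := by
    obtain ⟨i, -, j, -, hij, heq⟩ := Set.infinite_univ.exists_ne_map_eq_of_mapsTo
      (fun i _ => (h i).1 : Set.MapsTo e Set.univ F) hfin
    rcases hij.lt_or_gt with hlt | hlt
    · exact ⟨j - i, by omega, i, by rw [heq]; congr 1; omega⟩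
    · exact ⟨i - j, by omega, j, by rw [← heq]; congr 1; omega⟩
  obtain ⟨hd0, i, hi⟩ := Nat.find_spec hex
  -- With `d` the least gap between equal edges, any `d` consecutive edges are distinct; the closed
  -- walk is cut from `e (i + 1), …, e (i + d) = e i`.
  set d := Nat.find hex with hd
  have hmin : ∀ a b, a < b → b < a + d → e a ≠ e b := fun a b hab hbd heq =>
    Nat.find_min hex (m := b - a) (by omega)
      ⟨by omega, a, by rw [heq]; congr 1; omega⟩
  have hd2 : 2 ≤ d := by
    by_contra hlt
    have h1 : d = 1 := by omega
    rw [h1] at hi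
    exact (h i).2.2.2.2 hi
  have hinj : Set.InjOn (fun l => e (i + 1 + l)) (Set.Iio d) := by
    intro a ha b hb hab
    simp only [Set.mem_Iio] at ha hb
    by_contra hne
    rcases Nat.lt_or_gt_of_ne hne with hlt | hlt
    · exact hmin _ _ (by omega) (by omega) hab
    · exact hmin _ _ (by omega) (by omega) hab.symm
  -- If the vertices already agree, the walk closes before its last edge. Otherwise the last edge,
  -- being `e i`, contains both `v (i + d)` and `v (i + 1)` and closes it.
  by_cases hv : v (i + d) = v (i + 1)
  · refine ⟨d - 1, fun l => v (i + 1 + l), fun l => e (i + 1 + l), ?_, ?_, ?_, fun l hl => ?_⟩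
    · by_contra hlt
      have h1 : d = 2 := by omega
      rw [h1] at hv
      exact (h (i + 1)).2.2.2.1 hv.symm
    · change v (i + 1 + (d - 1)) = v (i + 1)
      rw [← hv]
      congr 1
      omega
    · exact hinj.mono (Set.Iio_subset_Iio (by omega))
    · obtain ⟨h1, h2, h3, h4, -⟩ := h (i + 1 + l)
      exact ⟨h1, h2, h3, h4⟩
  · refine ⟨d, fun l => if l = d then v (i + 1) else v (i + 1 + l), fun l => e (i + 1 + l), hd2, ?_,
      hinj, fun l hl => ?_⟩
    · simp
    · obtain ⟨h1, h2, h3, h4, -⟩ := h (i + 1 + l)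
      simp only [hl.ne, if_false]
      by_cases hl1 : l + 1 = d
      · have h5 : i + 1 + l = i + d := by omega
        simp only [hl1, if_true]
        refine ⟨h1, h2, ?_, ?_⟩
        · rw [h5, ← hi]
          exact (h i).2.2.1
        · rw [h5]
          exact hv
      · simp only [hl1, if_false]
        exact ⟨h1, h2, h3, h4⟩

lemma exists_injective_range_eq {ι : Type*} [Finite ι] {s : Set α} (hs : s.Finite)
    (hn : s.ncard = Nat.card ι) : ∃ f : ι → α, f.Injective ∧ Set.range f = s := by
  have := hs.to_subtype
  rw [← Nat.card_coe_set_eq] at hn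
  let q := (Finite.equivFinOfCardEq hn).trans (Finite.equivFin ι).symm
  refine ⟨fun i => q.symm i, Subtype.coe_injective.comp q.symm.injective, ?_⟩
  ext a
  constructor
  · rintro ⟨i, rfl⟩
    exact (q.symm i).2
  · intro ha
    exact ⟨q ⟨a, ha⟩, by simp⟩

lemma card_hypercycleVertex {g : ℕ} (hk : 2 ≤ k) :
    Nat.card (Fin g ⊕ Fin g × Fin (k - 2)) = (k - 1) * g := by
  obtain ⟨l, rfl⟩ := Nat.exists_eq_add_of_le hk
  simp only [Nat.card_eq_fintype_card, Fintype.card_sum, Fintype.card_prod, Fintype.card_fin]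
  have h1 : 2 + l - 2 = l := by omega
  have h2 : 2 + l - 1 = l + 1 := by omega
  rw [h1, h2]
  ring

lemma iUnion_hypercycleEdge {g : ℕ} : ⋃ i, hypercycleEdge g k i = Set.univ := by
  refine Set.eq_univ_of_forall fun b => Set.mem_iUnion.2 ?_
  rcases b with i | ⟨i, j⟩
  · exact ⟨i, by simp [hypercycleEdge]⟩
  · exact ⟨i, by simp [hypercycleEdge]⟩

/-- An injection of the vertices of a hypercycle that maps its edges to edges. -/
structure IsCycleEmbedding (G : Hypergraph α) (k g : ℕ)
    (φ : Fin g ⊕ Fin g × Fin (k - 2) → α) : Prop where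
  injective : φ.Injective
  image_mem : ∀ i, φ '' hypercycleEdge g k i ∈ E(G)

/-- A unicyclic hypergraph contains a hypercycle. -/
theorem IsUnicyclic.exists_isCycleEmbedding (hG : G.IsUnicyclic k) (hk : 2 ≤ k) :
    ∃ g, 2 ≤ g ∧ ∃ φ, G.IsCycleEmbedding k g φ := by
  have := hG.finite.to_subtype
  have hE : E(G).Finite := finite_edgeSet
  have hk1 : 1 ≤ k := by omega
  obtain ⟨F, hF, ⟨e₀, he₀⟩, hcore⟩ := hG.exists_core hk1
  obtain ⟨v₀, hv₀⟩ := hG.uniform.nonempty_of_mem hk1 (hF he₀)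
  obtain ⟨v, e, hwalk⟩ := exists_nonbacktracking_walk he₀ hv₀ hcore
  obtain ⟨g, u, c, hg, hug, hinj, hc⟩ := exists_closed_walk (hE.subset hF) hwalk
  have henum : ∀ i : Fin g, ∃ f : Fin (k - 2) → α, f.Injective ∧
      Set.range f = c i \ {u i, u (i + 1)} := fun i => by
    obtain ⟨h1, h2, h3, h4⟩ := hc i i.2
    have hcf := finite_of_mem_edgeSet (hF h1)
    refine exists_injective_range_eq (hcf.subset Set.sdiff_subset) ?_
    rw [Set.ncard_sdiff (Set.insert_subset h2 (Set.singleton_subset_iff.2 h3)),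
      hG.uniform _ (hF h1), Set.ncard_pair h4, Nat.card_fin]
  choose f hfinj hf using henum
  let φ : Fin g ⊕ Fin g × Fin (k - 2) → α := Sum.elim (fun i => u i) fun p => f p.1 p.2
  have hφ : ∀ i, φ '' hypercycleEdge g k i = c i := fun i => by
    obtain ⟨h1, h2, h3, h4⟩ := hc i i.2
    have hsucc : u (cyclicSucc i : Fin g) = u (i + 1) := by
      rcases (Nat.succ_le_of_lt i.2).lt_or_eq with hlt | heq
      · simp [cyclicSucc, Nat.mod_eq_of_lt hlt]
      · simp only [cyclicSucc, Nat.succ_eq_add_one] at heq ⊢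
        rw [heq, Nat.mod_self, hug]
    rw [hypercycleEdge, Set.image_union, Set.image_pair, ← Set.range_comp]
    have h5 : φ ∘ (fun j => Sum.inr (i, j)) = f i := rfl
    have h6 : φ (Sum.inl (cyclicSucc i)) = u (i + 1) := hsucc
    rw [h5, h6, hf i]
    exact Set.union_sdiff_cancel (Set.insert_subset h2 (Set.singleton_subset_iff.2 h3))
  refine ⟨g, hg, φ, ?_, fun i => by rw [hφ]; exact hF (hc i i.2).1⟩
  have hncard : (c '' Set.Iio g).ncard = g := by
    rw [hinj.ncard_image]
    simp [Set.ncard_eq_toFinset_card']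
  -- A priori `φ` may identify vertices of different edges. But the `g` edges cover at least `(k -
  -- 1) g` vertices, as many as the domain of `φ` has, so `φ` is injective.
  have hle := hG.le_ncard_sUnion hk1 (F := c '' Set.Iio g)
    (by rintro _ ⟨i, hi, rfl⟩; exact hF (hc i hi).1) ⟨c 0, 0, by simp; omega, rfl⟩
  have hrange : ⋃₀ (c '' Set.Iio g) = φ '' Set.univ := by
    rw [← iUnion_hypercycleEdge, Set.image_iUnion, Set.sUnion_image]
    ext a
    simp only [hφ, Set.mem_iUnion, Set.mem_Iio, exists_prop]
    exact ⟨fun ⟨i, hi, ha⟩ => ⟨⟨i, hi⟩, ha⟩, fun ⟨i, ha⟩ => ⟨i, i.2, ha⟩⟩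
  rw [hncard, hrange, ← card_hypercycleVertex hk, ← Set.ncard_univ] at hle
  exact Set.injOn_univ.1 (Set.injOn_of_ncard_image_eq (le_antisymm (Set.ncard_image_le) hle))

end Cycle

end Hypergraph

namespace Hypergraph

/-! ### Vertex weights on a hypercycle induced by edge weights. -/

section Hypercycle

variable {g k : ℕ}

lemma cyclicSucc_injective : Function.Injective (cyclicSucc (g := g)) := by
  intro i j h
  have h1 : (i.val + 1) % g = (j.val + 1) % g := congrArg Fin.val h
  have hi := i.2
  have hj := j.2
  ext
  rcases (Nat.succ_le_of_lt hi).lt_or_eq with h2 | h2 <;>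
    rcases (Nat.succ_le_of_lt hj).lt_or_eq with h3 | h3 <;>
    simp only [Nat.succ_eq_add_one] at h2 h3
  · rw [Nat.mod_eq_of_lt h2, Nat.mod_eq_of_lt h3] at h1
    omega
  · rw [Nat.mod_eq_of_lt h2, h3, Nat.mod_self] at h1
    omega
  · rw [Nat.mod_eq_of_lt h3, h2, Nat.mod_self] at h1
    omega
  · omega

/-- The cyclic successor as a permutation. -/
noncomputable def cyclicPerm (g : ℕ) : Equiv.Perm (Fin g) :=
  Equiv.ofBijective cyclicSucc cyclicSucc_injective.bijective_of_finite

@[simp]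
lemma cyclicPerm_apply (i : Fin g) : cyclicPerm g i = cyclicSucc i := rfl

lemma cyclicPerm_val (i : Fin g) : (cyclicPerm g i : ℕ) = (i + 1) % g := rfl

lemma cyclicPerm_pow_zero (hg : 0 < g) (n : ℕ) :
    ((cyclicPerm g ^ n) ⟨0, hg⟩ : ℕ) = n % g := by
  induction n with
  | zero => simp
  | succ n ih => rw [pow_succ', Equiv.Perm.mul_apply, cyclicPerm_val, ih, Nat.mod_add_mod]

lemma cyclicSucc_ne (hg : 2 ≤ g) (i : Fin g) : cyclicSucc i ≠ i := by
  intro h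
  have h1 : (i.val + 1) % g = i.val := congrArg Fin.val h
  rcases (Nat.succ_le_of_lt i.2).lt_or_eq with h2 | h2 <;> simp only [Nat.succ_eq_add_one] at h2
  · rw [Nat.mod_eq_of_lt h2] at h1
    omega
  · rw [h2, Nat.mod_self] at h1
    omega

lemma inl_mem_hypercycleEdge {a i : Fin g} :
    Sum.inl a ∈ hypercycleEdge g k i ↔ a = i ∨ a = cyclicSucc i := by
  simp [hypercycleEdge]

lemma inr_mem_hypercycleEdge {a i : Fin g} {j : Fin (k - 2)} :
    Sum.inr (a, j) ∈ hypercycleEdge g k i ↔ a = i := by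
  simp [hypercycleEdge, eq_comm]

lemma hypercycleEdge_injective (hk : 3 ≤ k) : Function.Injective (hypercycleEdge g k) := by
  intro i i' h
  have h1 : Sum.inr (i, ⟨0, by omega⟩) ∈ hypercycleEdge g k i := inr_mem_hypercycleEdge.2 rfl
  rw [h] at h1
  exact inr_mem_hypercycleEdge.1 h1

open Classical in
lemma sum_mem_hypercycleEdge (hg : 2 ≤ g) (i : Fin g) (x : Fin g ⊕ Fin g × Fin (k - 2) → ℝ) :
    (∑ b, if b ∈ hypercycleEdge g k i then x b else 0) =
      x (.inl i) + x (.inl (cyclicSucc i)) + ∑ j, x (.inr (i, j)) := by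
  rw [Fintype.sum_sum_type, Fintype.sum_prod_type]
  simp only [inl_mem_hypercycleEdge, inr_mem_hypercycleEdge]
  congr 1
  · have : ∀ a, (if a = i ∨ a = cyclicSucc i then x (.inl a) else 0) =
        (if a = i then x (.inl a) else 0) + if a = cyclicSucc i then x (.inl a) else 0 := fun a => by
      by_cases h1 : a = i
      · subst h1; simp [(cyclicSucc_ne hg a).symm]
      · simp [h1]
    simp [this, Finset.sum_add_distrib]
  · rw [Finset.sum_eq_single i (fun a _ ha => by simp [ha]) (by simp)]
    simp

open Classical in
lemma sum_edges_inl (hg : 2 ≤ g) (a : Fin g) (F : Fin g → ℝ) :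
    (∑ i, if Sum.inl a ∈ hypercycleEdge g k i then F i else 0) =
      F a + F ((cyclicPerm g).symm a) := by
  have h0 : (cyclicPerm g).symm a ≠ a := fun h => by
    have := cyclicSucc_ne hg a
    rw [← cyclicPerm_apply, Equiv.symm_apply_eq] at *
    exact this h.symm
  have : ∀ i, (if Sum.inl a ∈ hypercycleEdge g k i then F i else 0) =
      (if a = i then F i else 0) + if (cyclicPerm g).symm a = i then F i else 0 := fun i => by
    simp only [inl_mem_hypercycleEdge, ← cyclicPerm_apply, ← Equiv.symm_apply_eq]
    by_cases h1 : a = i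
    · subst h1; simp [h0]
    · simp [h1]
  simp [this, Finset.sum_add_distrib]

open Classical in
lemma sum_edges_inr (a : Fin g) (j : Fin (k - 2)) (F : Fin g → ℝ) :
    (∑ i, if Sum.inr (a, j) ∈ hypercycleEdge g k i then F i else 0) = F a := by
  simp [inr_mem_hypercycleEdge]

/-- Vertex weights induced on the hypercycle by the edge weights `S`, with the extra weight `z` at
the vertex `u` of degree one. -/
noncomputable def inducedWeight (k : ℕ) (r : ℝ) (S : Fin g → ℝ) (u : Fin g × Fin (k - 2))
    (z : ℝ) : Fin g ⊕ Fin g × Fin (k - 2) → ℝ :=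
  Sum.elim (fun a => (S a + S ((cyclicPerm g).symm a)) / (r + 2))
    fun p => S p.1 / (r + 1) + if p = u then z else 0

/-- The sum of `inducedWeight` over an edge. -/
noncomputable def inducedSum (k : ℕ) (r : ℝ) (S : Fin g → ℝ) (u : Fin g × Fin (k - 2))
    (z : ℝ) (i : Fin g) : ℝ :=
  (2 * S i + S (cyclicSucc i) + S ((cyclicPerm g).symm i)) / (r + 2) +
    ((k : ℝ) - 2) * (S i / (r + 1)) + if i = u.1 then z else 0

variable {r z : ℝ} {S : Fin g → ℝ} {u : Fin g × Fin (k - 2)}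

lemma inducedWeight_pos (hr : 0 < r) (hS : ∀ i, 0 < S i) (hz : 0 < S u.1 / (r + 1) + z)
    (b : Fin g ⊕ Fin g × Fin (k - 2)) : 0 < inducedWeight k r S u z b := by
  rcases b with a | p
  · have h1 := hS a
    have h2 := hS ((cyclicPerm g).symm a)
    simp only [inducedWeight, Sum.elim_inl]
    positivity
  · have h1 := hS p.1
    simp only [inducedWeight, Sum.elim_inr]
    split_ifs with h
    · subst h; exact hz
    · rw [add_zero]; positivity

open Classical in
lemma sum_inducedWeight (hg : 2 ≤ g) (hk : 2 ≤ k) (i : Fin g) :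
    (∑ b, if b ∈ hypercycleEdge g k i then inducedWeight k r S u z b else 0) =
      inducedSum k r S u z i := by
  have hk' : ((k - 2 : ℕ) : ℝ) = (k : ℝ) - 2 := by push_cast [hk]; ring
  rw [sum_mem_hypercycleEdge hg]
  have h1 : (cyclicPerm g).symm (cyclicSucc i) = i := (cyclicPerm g).symm_apply_apply i
  have h2 : ∑ j : Fin (k - 2), (if (i, j) = u then z else 0) = if i = u.1 then z else 0 := by
    obtain ⟨a, c⟩ := u
    by_cases hia : i = a
    · subst hia; simp
    · simp [hia]
  simp only [inducedWeight, inducedSum, Sum.elim_inl, Sum.elim_inr, h1, Finset.sum_add_distrib, h2]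
  simp only [Finset.sum_const, Finset.card_univ, Fintype.card_fin, nsmul_eq_mul, hk']
  ring

open Classical in
/-- The vertex weights satisfy `(r + d) x = ` sum of the weights of the incident edges, up to the
extra weight at `u`. -/
lemma mul_inducedWeight (hg : 2 ≤ g) (hr : 0 < r) (b : Fin g ⊕ Fin g × Fin (k - 2)) :
    r * inducedWeight k r S u z b =
      (∑ i, if b ∈ hypercycleEdge g k i then S i - inducedWeight k r S u z b else 0) +
        if b = .inr u then (r + 1) * z else 0 := by
  rcases b with a | ⟨a, j⟩
  · rw [sum_edges_inl hg]
    simp only [inducedWeight, Sum.elim_inl, reduceCtorEq, if_false]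
    field_simp
    ring
  · rw [sum_edges_inr]
    simp only [inducedWeight, Sum.elim_inr, Sum.inr.injEq]
    split_ifs
    · field_simp
      ring
    · field_simp
      ring

open Classical in
/-- The quadratic form of the hypercycle at the induced vertex weights. -/
lemma form_inducedWeight (hg : 2 ≤ g) (hk : 2 ≤ k) (hr : 0 < r) :
    ∑ i, ((∑ b, if b ∈ hypercycleEdge g k i then inducedWeight k r S u z b else 0) ^ 2 -
        ∑ b, if b ∈ hypercycleEdge g k i then inducedWeight k r S u z b ^ 2 else 0) -
      r * ∑ b, inducedWeight k r S u z b ^ 2 =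
    ∑ i, inducedSum k r S u z i * (inducedSum k r S u z i - S i) -
      (r + 1) * z * inducedWeight k r S u z (.inr u) := by
  set x := inducedWeight k r S u z with hx
  -- Pair the vertex equation `mul_inducedWeight` with `x` and exchange the sums; the squares then
  -- cancel against those of the quadratic form.
  have h1 : r * ∑ b, x b ^ 2 =
      ∑ i, (S i * inducedSum k r S u z i -
        ∑ b, if b ∈ hypercycleEdge g k i then x b ^ 2 else 0) + (r + 1) * z * x (.inr u) := by
    calc r * ∑ b, x b ^ 2 = ∑ b, x b * (r * x b) := by
          rw [Finset.mul_sum]; exact Finset.sum_congr rfl fun b _ => by ring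
      _ = ∑ b, ((∑ i, if b ∈ hypercycleEdge g k i then x b * (S i - x b) else 0) +
            if b = .inr u then (r + 1) * z * x b else 0) := by
          refine Finset.sum_congr rfl fun b _ => ?_
          rw [hx, mul_inducedWeight hg hr, ← hx, mul_add, Finset.mul_sum]
          congr 1
          · exact Finset.sum_congr rfl fun i _ => by split_ifs <;> simp
          · split_ifs <;> ring
      _ = _ := by
          rw [Finset.sum_add_distrib, Finset.sum_comm, Finset.sum_ite_eq' Finset.univ (Sum.inr u)]
          simp only [Finset.mem_univ, if_true]
          congr 1
          refine Finset.sum_congr rfl fun i _ => ?_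
          rw [← sum_inducedWeight hg hk, Finset.mul_sum, ← Finset.sum_sub_distrib]
          refine Finset.sum_congr rfl fun b _ => ?_
          split_ifs <;> ring
  rw [h1, ← sub_sub, ← Finset.sum_sub_distrib]
  congr 1
  refine Finset.sum_congr rfl fun i _ => ?_
  rw [hx, sum_inducedWeight hg hk]
  ring

end Hypercycle

end Hypergraph

namespace Hypergraph

/-! ### Test vectors on a hypercycle with one attached edge. -/

section TestVector

variable {α : Type*} {G : Hypergraph α} {g k : ℕ} {φ : Fin g ⊕ Fin g × Fin (k - 2) → α}

lemma finsum_mem_const {β : Type*} {s : Set β} (hs : s.Finite) (c : ℝ) :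
    ∑ᶠ _v ∈ s, c = s.ncard * c := by
  rw [finsum_mem_eq_finite_toFinset_sum _ hs, Finset.sum_const, nsmul_eq_mul,
    Set.ncard_eq_toFinset_card _ hs]

open Classical in
lemma finsum_mem_eq_sum_ite {β : Type*} [Fintype β] (s : Set β) (x : β → ℝ) :
    ∑ᶠ v ∈ s, x v = ∑ v, if v ∈ s then x v else 0 := by
  rw [← finsum_eq_sum_of_fintype]
  refine finsum_congr fun v => ?_
  by_cases hs : v ∈ s <;> simp [hs]

/-- The discarded edges have nonnegative forms because `X` is nonnegative. -/
lemma sum_le_finsum_edgeForm [Finite V(G)] {ι : Type*} [Fintype ι] {e : ι → Set α}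
    (he : e.Injective) (heE : ∀ i, e i ∈ E(G)) {X : α → ℝ} (hX : ∀ v, 0 ≤ X v) :
    ∑ i, edgeForm X (e i) ≤ ∑ᶠ s ∈ E(G), edgeForm X s := by
  classical
  rw [finsum_mem_eq_finite_toFinset_sum _ finite_edgeSet,
    ← Finset.sum_image (f := edgeForm X) he.injOn]
  refine Finset.sum_le_sum_of_subset_of_nonneg ?_ fun s hs _ => ?_
  · intro s hs
    obtain ⟨i, -, rfl⟩ := Finset.mem_image.1 hs
    simpa using heE i
  · exact edgeForm_nonneg hX (finite_of_mem_edgeSet (by simpa using hs))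

/-- The vertex weights `x` on an embedded hypercycle, `y` on the other vertices of the edge `P`, and
`0` elsewhere. -/
noncomputable def pendantVector (φ : Fin g ⊕ Fin g × Fin (k - 2) → α) (P : Set α)
    (x : Fin g ⊕ Fin g × Fin (k - 2) → ℝ) (y : ℝ) : α → ℝ :=
  Function.extend φ x (P.indicator fun _ => y)

variable {P : Set α} {b₀ : Fin g ⊕ Fin g × Fin (k - 2)}
  {x : Fin g ⊕ Fin g × Fin (k - 2) → ℝ} {y : ℝ}

lemma pendantVector_apply (hφ : φ.Injective) (b : Fin g ⊕ Fin g × Fin (k - 2)) :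
    pendantVector φ P x y (φ b) = x b :=
  hφ.extend_apply _ _ _

lemma pendantVector_of_notMem {v : α} (hv : v ∉ Set.range φ) :
    pendantVector φ P x y v = P.indicator (fun _ => y) v :=
  Function.extend_apply' _ _ _ fun ⟨b, hb⟩ => hv ⟨b, hb⟩

lemma pendantVector_nonneg (hφ : φ.Injective) (hx : ∀ b, 0 ≤ x b) (hy : 0 ≤ y) (v : α) :
    0 ≤ pendantVector φ P x y v := by
  by_cases hv : v ∈ Set.range φ
  · obtain ⟨b, rfl⟩ := hv
    rw [pendantVector_apply hφ]
    exact hx b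
  · rw [pendantVector_of_notMem hv]
    exact Set.indicator_nonneg (fun _ _ => hy) v

lemma pendantVector_of_mem_diff (hP : P ∩ Set.range φ = {φ b₀}) {v : α} (hv : v ∈ P \ {φ b₀}) :
    pendantVector φ P x y v = y := by
  rw [pendantVector_of_notMem, Set.indicator_of_mem hv.1]
  exact fun h => hv.2 (hP ▸ ⟨hv.1, h⟩)

lemma finsum_pendant_sdiff (hP : P ∩ Set.range φ = {φ b₀}) (hPf : P.Finite) (hPk : P.ncard = k)
    (hk : 1 ≤ k) (F : ℝ → ℝ) :
    ∑ᶠ v ∈ P \ {φ b₀}, F (pendantVector φ P x y v) = ((k : ℝ) - 1) * F y := by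
  rw [finsum_mem_congr rfl fun v hv => by rw [pendantVector_of_mem_diff hP hv],
    finsum_mem_const (hPf.subset Set.sdiff_subset)]
  have h : φ b₀ ∈ P := (hP.symm.subset rfl).1
  rw [Set.ncard_sdiff_singleton_of_mem h, hPk]
  push_cast [hk]
  ring

lemma finsum_pendant (hφ : φ.Injective) (hP : P ∩ Set.range φ = {φ b₀}) (hPf : P.Finite)
    (hPk : P.ncard = k) (hk : 1 ≤ k) (F : ℝ → ℝ) :
    ∑ᶠ v ∈ P, F (pendantVector φ P x y v) = F (x b₀) + ((k : ℝ) - 1) * F y := by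
  have h : φ b₀ ∈ P := (hP.symm.subset rfl).1
  have hins : P = insert (φ b₀) (P \ {φ b₀}) := by
    rw [Set.insert_sdiff_singleton, Set.insert_eq_of_mem h]
  conv_lhs => rw [hins]
  rw [finsum_mem_insert _ (by simp) (hPf.subset Set.sdiff_subset),
    ← hins, pendantVector_apply hφ, finsum_pendant_sdiff hP hPf hPk hk]

lemma finsum_sq_pendantVector (hφ : G.IsCycleEmbedding k g φ)
    (hP : P ∩ Set.range φ = {φ b₀}) (hPE : P ∈ E(G)) (hPf : P.Finite) (hPk : P.ncard = k)
    (hk : 1 ≤ k) :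
    ∑ᶠ v ∈ V(G), pendantVector φ P x y v ^ 2 = ∑ b, x b ^ 2 + ((k : ℝ) - 1) * y ^ 2 := by
  have hV : Set.range φ ⊆ V(G) := by
    rw [← Set.image_univ, ← iUnion_hypercycleEdge, Set.image_iUnion]
    exact Set.iUnion_subset fun i => (hφ.image_mem i).subset_vertexSet
  rw [finsum_mem_inter_support_eq' _ V(G) (Set.range φ ∪ P \ {φ b₀}), finsum_mem_union,
    finsum_mem_range hφ.injective, finsum_pendant_sdiff hP hPf hPk hk fun t => t ^ 2]
  · simp only [pendantVector_apply hφ.injective, finsum_eq_sum_of_fintype]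
  · rw [Set.disjoint_left]
    exact fun v hv hvP => hvP.2 (hP ▸ ⟨hvP.1, hv⟩)
  · exact Set.finite_range φ
  · exact hPf.subset Set.sdiff_subset
  · intro v hv
    refine ⟨fun _ => ?_, ?_⟩
    · by_contra hcon
      rw [Set.mem_union, not_or] at hcon
      refine hv ?_
      have hvP : v ∉ P := fun h => hcon.2 ⟨h, fun h2 => hcon.1 (h2 ▸ Set.mem_range_self b₀)⟩
      simp [pendantVector_of_notMem hcon.1, hvP]
    · rintro (h | h)
      · exact hV h
      · exact hPE.subset_vertexSet h.1

open Classical in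
lemma edgeForm_image (hφ : φ.Injective) (i : Fin g) :
    edgeForm (pendantVector φ P x y) (φ '' hypercycleEdge g k i) =
      (∑ b, if b ∈ hypercycleEdge g k i then x b else 0) ^ 2 -
        ∑ b, if b ∈ hypercycleEdge g k i then x b ^ 2 else 0 := by
  rw [edgeForm, finsum_mem_image hφ.injOn, finsum_mem_image hφ.injOn]
  simp only [pendantVector_apply hφ]
  rw [finsum_mem_eq_sum_ite, finsum_mem_eq_sum_ite]

/-- An edge that meets the vertices of the embedded hypercycle in one vertex is not one of the edges
of the hypercycle. -/
lemma image_hypercycleEdge_ne (hg : 2 ≤ g) (hφ : φ.Injective) (hP : P ∩ Set.range φ = {φ b₀})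
    (i : Fin g) : φ '' hypercycleEdge g k i ≠ P := by
  rintro rfl
  rw [Set.inter_eq_left.2 (Set.image_subset_range _ _)] at hP
  have h1 : φ (.inl i) ∈ φ '' hypercycleEdge g k i := ⟨_, inl_mem_hypercycleEdge.2 (Or.inl rfl), rfl⟩
  have h2 : φ (.inl (cyclicSucc i)) ∈ φ '' hypercycleEdge g k i :=
    ⟨_, inl_mem_hypercycleEdge.2 (Or.inr rfl), rfl⟩
  rw [hP, Set.mem_singleton_iff] at h1 h2
  exact cyclicSucc_ne hg i (Sum.inl_injective (hφ (h2.trans h1.symm)))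

open Classical in
lemma sum_add_le_finsum_edgeForm [Finite V(G)] (hg : 2 ≤ g) (hk : 3 ≤ k) (hu : G.IsUniform k)
    (hφ : G.IsCycleEmbedding k g φ) (hP : P ∩ Set.range φ = {φ b₀}) (hPE : P ∈ E(G))
    (hx : ∀ b, 0 ≤ x b) (hy : 0 ≤ y) :
    ∑ i, ((∑ b, if b ∈ hypercycleEdge g k i then x b else 0) ^ 2 -
        ∑ b, if b ∈ hypercycleEdge g k i then x b ^ 2 else 0) +
      ((x b₀ + ((k : ℝ) - 1) * y) ^ 2 - (x b₀ ^ 2 + ((k : ℝ) - 1) * y ^ 2)) ≤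
    ∑ᶠ e ∈ E(G), edgeForm (pendantVector φ P x y) e := by
  have hPf := finite_of_mem_edgeSet hPE
  have hinj : Function.Injective (fun o : Option (Fin g) =>
      o.elim P fun i => φ '' hypercycleEdge g k i) := by
    rintro (_ | i) (_ | j) h
    · rfl
    · exact absurd h.symm (image_hypercycleEdge_ne hg hφ.injective hP j)
    · exact absurd h (image_hypercycleEdge_ne hg hφ.injective hP i)
    · exact congrArg some (hypercycleEdge_injective hk
        (Set.image_injective.2 hφ.injective h))
  have h := sum_le_finsum_edgeForm (G := G) hinj
    (by rintro (_ | i); exacts [hPE, hφ.image_mem i])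
    (pendantVector_nonneg (P := P) hφ.injective hx hy)
  rw [Fintype.sum_option] at h
  simp only [Option.elim_none, Option.elim_some, edgeForm_image hφ.injective] at h
  refine le_trans (le_of_eq ?_) h
  rw [add_comm, edgeForm, finsum_pendant hφ.injective hP hPf (hu P hPE) (by omega) fun t => t,
    finsum_pendant hφ.injective hP hPf (hu P hPE) (by omega) fun t => t ^ 2]

open Classical in
/-- The Rayleigh quotient of a test vector on a hypercycle with one attached edge bounds the
spectral radius from below; strictly so if the inequality is strict or if the vector vanishes at
some vertex. -/
theorem lt_specRadius_of_pendant [Finite V(G)] (hc : G.IsConnected) (hg : 2 ≤ g) (hk : 3 ≤ k)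
    (hu : G.IsUniform k) (hφ : G.IsCycleEmbedding k g φ) (hP : P ∩ Set.range φ = {φ b₀})
    (hPE : P ∈ E(G)) (hx : ∀ b, 0 < x b) (hy : 0 ≤ y) {r : ℝ} (hr : 0 < r)
    (hform : r * (∑ b, x b ^ 2 + ((k : ℝ) - 1) * y ^ 2) ≤
      ∑ i, ((∑ b, if b ∈ hypercycleEdge g k i then x b else 0) ^ 2 -
        ∑ b, if b ∈ hypercycleEdge g k i then x b ^ 2 else 0) +
      ((x b₀ + ((k : ℝ) - 1) * y) ^ 2 - (x b₀ ^ 2 + ((k : ℝ) - 1) * y ^ 2)))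
    (hstrict : r * (∑ b, x b ^ 2 + ((k : ℝ) - 1) * y ^ 2) <
      ∑ i, ((∑ b, if b ∈ hypercycleEdge g k i then x b else 0) ^ 2 -
        ∑ b, if b ∈ hypercycleEdge g k i then x b ^ 2 else 0) +
      ((x b₀ + ((k : ℝ) - 1) * y) ^ 2 - (x b₀ ^ 2 + ((k : ℝ) - 1) * y ^ 2)) ∨
      ∃ v ∈ V(G), pendantVector φ P x y v = 0) :
    r / ((k : ℝ) - 1) < G.specRadius := by
  have hPf := finite_of_mem_edgeSet hPE
  have hk' : 0 < (k : ℝ) - 1 := by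
    have : (3 : ℝ) ≤ k := by exact_mod_cast hk
    linarith
  have hsum := sum_add_le_finsum_edgeForm hg hk hu hφ hP hPE (fun b => (hx b).le) hy
  have hsq := finsum_sq_pendantVector (x := x) (y := y) hφ hP hPE hPf (hu P hPE) (by omega)
  rw [div_lt_iff₀' hk']
  rcases hstrict with hlt | ⟨v, hv, hv0⟩
  · have hray := sum_edgeForm_le (by omega) hu (pendantVector φ P x y)
    rw [hsq] at hray
    have hN : 0 < ∑ b, x b ^ 2 + ((k : ℝ) - 1) * y ^ 2 := by
      have : 0 < ∑ b, x b ^ 2 :=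
        Finset.sum_pos (fun b _ => pow_pos (hx b) 2) ⟨b₀, Finset.mem_univ _⟩
      positivity
    exact lt_of_mul_lt_mul_right (hlt.trans_le (hsum.trans hray)) hN.le
  · refine hc.lt_specRadius_of_vanishing (by omega) hu
      (pendantVector_nonneg (P := P) hφ.injective (fun b => (hx b).le) hy) hr
      (by rw [hsq]; exact hform.trans hsum) (w := φ b₀) ?_ ?_ hv hv0
    · exact hPE.subset_vertexSet (hP.symm.subset rfl).1
    · rw [pendantVector_apply hφ.injective]
      exact hx b₀

end TestVector

end Hypergraph

namespace Hypergraph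

/-! ### Hypercycles as unicyclic hypergraphs and their spectral equation. -/

section Hypercycle

variable {g k : ℕ}

lemma isConnected_of_root {α : Type*} {G : Hypergraph α} {a : α} (ha : a ∈ V(G))
    (h : ∀ v ∈ V(G), Relation.ReflTransGen G.Adj a v) : G.IsConnected :=
  have : Std.Symm G.Adj := ⟨fun _ _ h => h.symm⟩
  ⟨⟨a, ha⟩, fun u hu v hv => (Std.Symm.symm _ _ (h u hu)).trans (h v hv)⟩

lemma vertexSet_hypercycle : V(hypercycle g k) = Set.univ := rfl

lemma edgeSet_hypercycle : E(hypercycle g k) = Set.range (hypercycleEdge g k) := rfl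

lemma ncard_hypercycleEdge (hg : 2 ≤ g) (hk : 2 ≤ k) (i : Fin g) :
    (hypercycleEdge g k i).ncard = k := by
  rw [hypercycleEdge, Set.ncard_union_eq, Set.ncard_pair, ← Set.image_univ,
    Set.ncard_image_of_injective, Set.ncard_univ, Nat.card_fin]
  · omega
  · intro a b h
    simpa using h
  · exact fun h => cyclicSucc_ne hg i (Sum.inl_injective h).symm
  · rw [Set.disjoint_left]
    rintro _ (rfl | rfl) ⟨j, hj⟩ <;> cases hj

lemma isUniform_hypercycle (hg : 2 ≤ g) (hk : 2 ≤ k) : (hypercycle g k).IsUniform k := by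
  rintro _ ⟨i, rfl⟩
  exact ncard_hypercycleEdge hg hk i

lemma ncard_vertexSet_hypercycle (hk : 2 ≤ k) : V(hypercycle g k).ncard = (k - 1) * g := by
  rw [vertexSet_hypercycle, Set.ncard_univ, card_hypercycleVertex hk]

lemma ncard_range_of_injective {ι β : Type*} {f : ι → β} (hf : f.Injective) :
    (Set.range f).ncard = Nat.card ι := by
  rw [← Set.image_univ, Set.ncard_image_of_injective _ hf, Set.ncard_univ]

lemma isConnected_hypercycle (hg : 0 < g) : (hypercycle g k).IsConnected := by
  have hinl : ∀ i (hi : i < g), Relation.ReflTransGen (hypercycle g k).Adj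
      (.inl ⟨0, hg⟩) (.inl ⟨i, hi⟩) := by
    intro i
    induction i with
    | zero => exact fun _ => Relation.ReflTransGen.refl
    | succ i ih =>
      intro hi
      refine (ih (by omega)).tail ⟨_, ⟨⟨i, by omega⟩, rfl⟩, ?_, ?_⟩
      · exact inl_mem_hypercycleEdge.2 (Or.inl rfl)
      · refine inl_mem_hypercycleEdge.2 (Or.inr ?_)
        ext
        exact (Nat.mod_eq_of_lt hi).symm
  refine isConnected_of_root (a := .inl ⟨0, hg⟩) (Set.mem_univ _) fun v _ => ?_
  rcases v with i | ⟨i, j⟩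
  · exact hinl i i.2
  · exact (hinl i i.2).tail ⟨_, ⟨i, rfl⟩, inl_mem_hypercycleEdge.2 (Or.inl rfl),
      inr_mem_hypercycleEdge.2 rfl⟩

theorem isUnicyclic_hypercycle (hg : 2 ≤ g) (hk : 3 ≤ k) : (hypercycle g k).IsUnicyclic k where
  finite := Set.toFinite _
  connected := isConnected_hypercycle (by omega)
  uniform := isUniform_hypercycle hg (by omega)
  count := by
    rw [ncard_vertexSet_hypercycle (by omega), edgeSet_hypercycle,
      ncard_range_of_injective (hypercycleEdge_injective hk), Nat.card_fin]
    push_cast [show 1 ≤ k by omega]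
    ring

/-- Edge weights reproduced by the vertex weights that they induce determine the spectral radius of
the hypercycle. -/
theorem specRadius_hypercycle_of_inducedSum (hg : 2 ≤ g) (hk : 3 ≤ k) {r : ℝ} (hr : 0 < r)
    {S : Fin g → ℝ} (hS : ∀ i, 0 < S i) {u : Fin g × Fin (k - 2)}
    (hT : ∀ i, inducedSum k r S u 0 i = S i) :
    (hypercycle g k).specRadius = r / ((k : ℝ) - 1) := by
  classical
  rw [specRadius_eq_maxModulus (isUniform_hypercycle hg (by omega)) (f := id) Function.injective_id
    Set.range_id (hypercycleEdge_injective hk) rfl]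
  have : Nonempty (Fin g ⊕ Fin g × Fin (k - 2)) := ⟨.inr u⟩
  refine Matrix.maxModulus_ofIncidence_eq (x := inducedWeight k r S u 0) (S := S) (by omega)
    (inducedWeight_pos hr hS ?_) hr.le (fun b => ?_) fun i => ?_
  · have := hS u.1
    rw [add_zero]
    positivity
  · rw [mul_inducedWeight hg hr]
    simp
  · rw [← hT i, ← sum_inducedWeight hg (by omega)]
    rfl

end Hypercycle

/-! ### Lollipops as unicyclic hypergraphs and their spectral equation. -/

section Lollipop

lemma card_pendantVertex {k : ℕ} (hk : 3 ≤ k) : Nat.card (Fin 1 ⊕ Fin 1 × Fin (k - 2)) = k - 1 := by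
  rw [card_hypercycleVertex (by omega), mul_one]

variable {g k : ℕ} (hg : 2 ≤ g) (hk : 3 ≤ k)

/-- The vertex of degree one of the hypercycle at which the lollipop has its pendant edge. -/
def lollipopRoot : Fin g × Fin (k - 2) :=
  (⟨0, by omega⟩, ⟨0, by omega⟩)

lemma pathEdge_one {α : Type*} (v : α) (t : Fin 1) :
    pathEdge v 1 k t = insert (Sum.inl v) (Set.range Sum.inr) := by
  obtain rfl := Subsingleton.elim t 0
  ext b
  rcases b with a | a | ⟨a, j⟩
  · simp [pathEdge, pathJunction]
  · obtain rfl := Subsingleton.elim a 0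
    simp [pathEdge, pathJunction]
  · obtain rfl := Subsingleton.elim a 0
    simp [pathEdge]

/-- The edges of a lollipop with one pendant edge, labelled by the edges of the hypercycle and
`none` for the pendant edge. -/
def lollipopEdge (o : Option (Fin g)) :
    Set ((Fin g ⊕ Fin g × Fin (k - 2)) ⊕ (Fin 1 ⊕ Fin 1 × Fin (k - 2))) :=
  o.elim (insert (Sum.inl (Sum.inr (lollipopRoot hg hk))) (Set.range Sum.inr))
    fun i => Sum.inl '' hypercycleEdge g k i

lemma vertexSet_lollipopTwo : V(lollipopTwo g k 1 hg hk) = Set.univ := by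
  refine Set.eq_univ_of_forall ?_
  rintro (b | b)
  · exact Or.inl ⟨b, Set.mem_univ _, rfl⟩
  · exact Or.inr ⟨b, rfl⟩

lemma edgeSet_lollipopTwo : E(lollipopTwo g k 1 hg hk) = Set.range (lollipopEdge hg hk) := by
  ext e
  constructor
  · rintro (⟨_, ⟨i, rfl⟩, rfl⟩ | ⟨t, rfl⟩)
    · exact ⟨some i, rfl⟩
    · exact ⟨none, (pathEdge_one _ t).symm⟩
  · rintro ⟨_ | i, rfl⟩
    · exact Or.inr ⟨0, pathEdge_one _ 0⟩
    · exact Or.inl ⟨_, ⟨i, rfl⟩, rfl⟩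

lemma lollipopEdge_none_inter :
    lollipopEdge hg hk none ∩ Set.range Sum.inl = {Sum.inl (Sum.inr (lollipopRoot hg hk))} := by
  ext (b | b) <;> simp [lollipopEdge]

lemma lollipopEdge_injective : Function.Injective (lollipopEdge hg hk) := by
  have hne := image_hypercycleEdge_ne hg Sum.inl_injective (lollipopEdge_none_inter hg hk)
  rintro (_ | i) (_ | j) h
  · rfl
  · exact absurd h.symm (hne j)
  · exact absurd h (hne i)
  · exact congrArg some (hypercycleEdge_injective hk (Set.image_injective.2 Sum.inl_injective h))

lemma isUniform_lollipopTwo : (lollipopTwo g k 1 hg hk).IsUniform k := by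
  intro e he
  rw [edgeSet_lollipopTwo] at he
  obtain ⟨_ | i, rfl⟩ := he
  · rw [lollipopEdge, Option.elim_none, Set.ncard_insert_of_notMem (by simp),
      ncard_range_of_injective Sum.inr_injective, card_pendantVertex hk]
    omega
  · rw [lollipopEdge, Option.elim_some, Set.ncard_image_of_injective _ Sum.inl_injective,
      ncard_hypercycleEdge hg (by omega)]

lemma ncard_vertexSet_lollipopTwo : V(lollipopTwo g k 1 hg hk).ncard = (k - 1) * (g + 1) := by
  rw [vertexSet_lollipopTwo, Set.ncard_univ, Nat.card_sum, card_hypercycleVertex (by omega),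
    card_pendantVertex hk]
  ring

lemma isCycleEmbedding_lollipopTwo :
    (lollipopTwo g k 1 hg hk).IsCycleEmbedding k g Sum.inl where
  injective := Sum.inl_injective
  image_mem i := by
    rw [edgeSet_lollipopTwo]
    exact ⟨some i, rfl⟩

lemma isConnected_lollipopTwo : (lollipopTwo g k 1 hg hk).IsConnected := by
  have hc := isConnected_hypercycle (g := g) (k := k) (by omega)
  have hroot : ∀ b, Relation.ReflTransGen (lollipopTwo g k 1 hg hk).Adj
      (.inl (.inr (lollipopRoot hg hk))) (.inl b) := fun b => by
    refine Relation.ReflTransGen.lift (p := (lollipopTwo g k 1 hg hk).Adj) Sum.inl ?_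
      _ _ (hc.2 (.inr (lollipopRoot hg hk)) (Set.mem_univ _) b (Set.mem_univ _))
    rintro a b ⟨_, ⟨i, rfl⟩, ha, hb⟩
    exact ⟨_, (isCycleEmbedding_lollipopTwo hg hk).image_mem i, ⟨a, ha, rfl⟩, ⟨b, hb, rfl⟩⟩
  refine isConnected_of_root (a := .inl (.inr (lollipopRoot hg hk)))
    (by rw [vertexSet_lollipopTwo]; trivial) fun v _ => ?_
  rcases v with b | b
  · exact hroot b
  · refine Relation.ReflTransGen.single ⟨lollipopEdge hg hk none, ?_, ?_, ?_⟩
    · rw [edgeSet_lollipopTwo]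
      exact Set.mem_range_self _
    · exact Set.mem_insert _ _
    · exact Or.inr ⟨b, rfl⟩

theorem isUnicyclic_lollipopTwo : (lollipopTwo g k 1 hg hk).IsUnicyclic k where
  finite := Set.toFinite _
  connected := isConnected_lollipopTwo hg hk
  uniform := isUniform_lollipopTwo hg hk
  count := by
    rw [ncard_vertexSet_lollipopTwo, edgeSet_lollipopTwo,
      ncard_range_of_injective (lollipopEdge_injective hg hk), Nat.card_eq_fintype_card,
      Fintype.card_option, Fintype.card_fin]
    push_cast [show 1 ≤ k by omega]
    ring

/-- Edge weights reproduced by the vertex weights that they induce determine the spectral radius of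
the lollipop. -/
theorem specRadius_lollipopTwo_of_inducedSum {r : ℝ} (hr : 0 < r)
    {S : Fin g → ℝ} (hS : ∀ i, 0 < S i) {s z : ℝ} (hs : 0 < s)
    (hT : ∀ i, inducedSum k r S (lollipopRoot hg hk) z i = S i)
    (hroot : (r + 2) * (S (lollipopRoot hg hk).1 / (r + 1) + z) = S (lollipopRoot hg hk).1 + s)
    (hpend : S (lollipopRoot hg hk).1 / (r + 1) + z + ((k : ℝ) - 1) * (s / (r + 1)) = s) :
    (lollipopTwo g k 1 hg hk).specRadius = r / ((k : ℝ) - 1) := by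
  classical
  set u := lollipopRoot hg hk with hu
  have hk2 : 2 ≤ k := by omega
  have hxu : 0 < S u.1 / (r + 1) + z := by
    have := hS u.1
    refine pos_of_mul_pos_right (b := _) (a := r + 2) ?_ (by linarith)
    rw [hroot]
    positivity
  rw [specRadius_eq_maxModulus (isUniform_lollipopTwo hg hk) (f := id) Function.injective_id
    (by rw [Set.range_id, vertexSet_lollipopTwo]) (lollipopEdge_injective hg hk)
    (edgeSet_lollipopTwo hg hk).symm]
  have : Nonempty ((Fin g ⊕ Fin g × Fin (k - 2)) ⊕ (Fin 1 ⊕ Fin 1 × Fin (k - 2))) :=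
    ⟨.inl (.inr u)⟩
  have hinl : ∀ b, Sum.inl b ∈ lollipopEdge hg hk none ↔ b = .inr u := fun b => by
    simp [lollipopEdge, hu]
  have hinr : ∀ b, Sum.inr b ∈ lollipopEdge hg hk none := fun b => by simp [lollipopEdge]
  have hinl' : ∀ b i, Sum.inl b ∈ lollipopEdge hg hk (some i) ↔ b ∈ hypercycleEdge g k i :=
    fun b i => by simp [lollipopEdge]
  have hinr' : ∀ b i, Sum.inr b ∉ lollipopEdge hg hk (some i) := fun b i => by
    simp [lollipopEdge]
  refine Matrix.maxModulus_ofIncidence_eq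
    (x := Sum.elim (inducedWeight k r S u z) fun _ => s / (r + 1))
    (S := fun o => o.elim s S) hk2 ?_ hr.le ?_ ?_
  · rintro (b | b)
    · exact inducedWeight_pos hr hS hxu b
    · simp only [Sum.elim_inr]
      positivity
  · rintro (b | b)
    · simp only [id, Fintype.sum_option, hinl, hinl', Option.elim_none, Option.elim_some,
        Sum.elim_inl]
      rw [mul_inducedWeight hg hr, add_comm]
      congr 1
      by_cases hb : b = .inr u
      · subst hb
        simp only [if_true, inducedWeight, Sum.elim_inr]
        field_simp at hroot ⊢
        linarith
      · simp [hb]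
    · simp only [id, Fintype.sum_option, hinr, hinr', Option.elim_none, Sum.elim_inr, if_true,
        if_false, Finset.sum_const_zero, add_zero]
      field_simp
      ring
  · rintro (_ | i)
    · simp only [id, Fintype.sum_sum_type (α₁ := Fin g ⊕ Fin g × Fin (k - 2)), hinl, hinr,
        Option.elim_none, Sum.elim_inr, Sum.elim_inl, if_true, Finset.sum_ite_eq',
        Finset.mem_univ, Finset.sum_const, Finset.card_univ, nsmul_eq_mul,
        ← Nat.card_eq_fintype_card, card_pendantVertex hk]
      refine Eq.trans ?_ hpend
      simp only [inducedWeight, Sum.elim_inr, if_true]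
      push_cast [show 1 ≤ k by omega]
      ring
    · simp only [id, Fintype.sum_sum_type (α₁ := Fin g ⊕ Fin g × Fin (k - 2)), hinl', hinr',
        Option.elim_some, Sum.elim_inl, if_false, Finset.sum_const_zero, add_zero]
      rw [← hT i, ← sum_inducedWeight hg hk2]

end Lollipop

end Hypergraph

namespace Hypergraph

/-! ### The scalar equations for hypercycles and lollipops. -/

section Parameters

/-- `(k - 1)` times the spectral radius of the `k`-uniform hypercycles. -/
noncomputable def cycleRadius (k : ℕ) : ℝ :=
  (((k : ℝ) - 1) + √(((k : ℝ) - 1) ^ 2 + 8 * ((k : ℝ) - 1))) / 2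

/-- The ratio `(S (i + 1) + S (i - 1)) / S i` forced by the eigenvector equation on an edge of a
hypercycle, for the eigenvalue `r / (k - 1)`. -/
noncomputable def edgeRatio (k : ℕ) (r : ℝ) : ℝ :=
  (r + 2) * (r + 3 - k) / (r + 1) - 2

variable {k : ℕ}

lemma cycleRadius_sq (hk : 1 ≤ k) :
    cycleRadius k ^ 2 = ((k : ℝ) - 1) * (cycleRadius k + 2) := by
  have hk' : (0 : ℝ) ≤ (k : ℝ) - 1 := by
    have : (1 : ℝ) ≤ k := by exact_mod_cast hk
    linarith
  have h := Real.sq_sqrt (show 0 ≤ ((k : ℝ) - 1) ^ 2 + 8 * ((k : ℝ) - 1) by positivity)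
  rw [cycleRadius]
  linear_combination h / 4

lemma le_cycleRadius (hk : 1 ≤ k) : (k : ℝ) - 1 ≤ cycleRadius k := by
  have hk' : (0 : ℝ) ≤ (k : ℝ) - 1 := by
    have : (1 : ℝ) ≤ k := by exact_mod_cast hk
    linarith
  have h : (k : ℝ) - 1 ≤ √(((k : ℝ) - 1) ^ 2 + 8 * ((k : ℝ) - 1)) :=
    Real.le_sqrt_of_sq_le (by linarith)
  rw [cycleRadius]
  linarith

lemma cycleRadius_le (hk : 1 ≤ k) : cycleRadius k ≤ k + 2 := by
  have hk' : (1 : ℝ) ≤ k := by exact_mod_cast hk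
  have h : √(((k : ℝ) - 1) ^ 2 + 8 * ((k : ℝ) - 1)) ≤ k + 3 :=
    Real.sqrt_le_iff.2 ⟨by linarith, by nlinarith⟩
  rw [cycleRadius]
  linarith

/-- After clearing `r + 1` the claim is `r² ≥ (k - 1)(r + 2)`, whose positive root is `cycleRadius
k`. The bound makes `q + 1/q = edgeRatio k r` solvable with real positive `q`. -/
lemma two_le_edgeRatio (hk : 3 ≤ k) {r : ℝ} (hr : cycleRadius k ≤ r) : 2 ≤ edgeRatio k r := by
  have hk' : (3 : ℝ) ≤ k := by exact_mod_cast hk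
  have h0 := le_cycleRadius (k := k) (by omega)
  have h1 := cycleRadius_sq (k := k) (by omega)
  rw [edgeRatio, le_sub_iff_add_le, le_div_iff₀ (by linarith)]
  nlinarith [mul_nonneg (sub_nonneg.2 hr) (show 0 ≤ r + cycleRadius k - (k - 1) by linarith)]

lemma edgeRatio_cycleRadius (hk : 3 ≤ k) : edgeRatio k (cycleRadius k) = 2 := by
  have hk' : (3 : ℝ) ≤ k := by exact_mod_cast hk
  have h0 := le_cycleRadius (k := k) (by omega)
  have h1 := cycleRadius_sq (k := k) (by omega)
  rw [edgeRatio, sub_eq_iff_eq_add, div_eq_iff (by linarith)]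
  linear_combination h1

/-- `k + 2` serves only as a convenient right end for the intermediate value argument. -/
lemma three_le_edgeRatio (hk : 3 ≤ k) : 3 ≤ edgeRatio k (k + 2) := by
  have hk' : (3 : ℝ) ≤ k := by exact_mod_cast hk
  rw [edgeRatio, le_sub_iff_add_le, le_div_iff₀ (by linarith)]
  nlinarith

/-- The decaying solution of `q + q⁻¹ = c`. -/
noncomputable def decayRate (c : ℝ) : ℝ := (c - √(c ^ 2 - 4)) / 2

lemma decayRate_spec {c : ℝ} (hc : 2 ≤ c) :
    0 < decayRate c ∧ decayRate c ≤ 1 ∧ decayRate c ^ 2 + 1 = c * decayRate c := by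
  have h0 : 0 ≤ c ^ 2 - 4 := by nlinarith
  have h := Real.sq_sqrt h0
  have hlt : √(c ^ 2 - 4) < c := by
    rw [Real.sqrt_lt' (by linarith)]
    linarith
  have hle : c - 2 ≤ √(c ^ 2 - 4) := Real.le_sqrt_of_sq_le (by nlinarith)
  refine ⟨?_, ?_, ?_⟩
  · rw [decayRate]; linarith
  · rw [decayRate]; linarith
  · rw [decayRate]; linear_combination h / 4

/-- The difference of the two sides is `(q ^ (g - 1) - q ^ (h - 1)) (1 - q²)`. Thus `(q + q ^ (g -
1)) / (1 + q ^ g)`, the ratio of the weights of edges `1` and `0`, does not increase with the length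
of the cycle. -/
lemma decay_add_le {q : ℝ} (h0 : 0 ≤ q) (h1 : q ≤ 1) {g h : ℕ} (hg : 1 ≤ g) (hgh : g ≤ h) :
    (q + q ^ (h - 1)) * (1 + q ^ g) ≤ (q + q ^ (g - 1)) * (1 + q ^ h) := by
  obtain ⟨a, rfl⟩ := Nat.exists_eq_add_of_le' hg
  obtain ⟨b, rfl⟩ := Nat.exists_eq_add_of_le' (hg.trans hgh)
  have h2 : q ^ b ≤ q ^ a := pow_le_pow_of_le_one h0 h1 (by omega)
  simp only [Nat.add_sub_cancel, pow_succ]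
  nlinarith [mul_nonneg (sub_nonneg.2 h2) (show 0 ≤ 1 - q ^ 2 by nlinarith)]

/-- The eigenvalue equation of the lollipop over a hypercycle with `h` edges has a solution. -/
theorem exists_lollipop_parameter (hk : 3 ≤ k) {h : ℕ} (hh : 1 ≤ h) :
    ∃ r q : ℝ, 0 < r ∧ 0 < q ∧ q ≤ 1 ∧ 2 ≤ edgeRatio k r ∧ q ^ 2 + 1 = edgeRatio k r * q ∧
      ((edgeRatio k r + 1 / (r + 1)) * (edgeRatio k r - 1 / (r + 1)) - 1) * (1 + q ^ h) =
        2 * (q + q ^ (h - 1)) * (edgeRatio k r - 1 / (r + 1)) := by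
  have hk' : (3 : ℝ) ≤ k := by exact_mod_cast hk
  have h0 := le_cycleRadius (k := k) (by omega)
  set I := Set.Icc (cycleRadius k) (k + 2) with hI
  have hpos : ∀ r ∈ I, 0 < r + 1 := fun r hr => by linarith [hr.1]
  have hε : ContinuousOn (fun r : ℝ => 1 / (r + 1)) I :=
    ContinuousOn.div continuousOn_const (by fun_prop) fun r hr => (hpos r hr).ne'
  have hc : ContinuousOn (edgeRatio k) I :=
    (ContinuousOn.div (by fun_prop) (by fun_prop) fun r hr => (hpos r hr).ne').sub
      continuousOn_const
  have hq : ContinuousOn (fun r => decayRate (edgeRatio k r)) I :=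
    (hc.sub ((hc.pow 2).sub continuousOn_const).sqrt).div_const 2
  let F : ℝ → ℝ := fun r =>
    ((edgeRatio k r + 1 / (r + 1)) * (edgeRatio k r - 1 / (r + 1)) - 1) *
        (1 + decayRate (edgeRatio k r) ^ h) -
      2 * (decayRate (edgeRatio k r) + decayRate (edgeRatio k r) ^ (h - 1)) *
        (edgeRatio k r - 1 / (r + 1))
  have hF : ContinuousOn F I :=
    ((((hc.add hε).mul (hc.sub hε)).sub continuousOn_const).mul
      (continuousOn_const.add (hq.pow h))).sub
      ((continuousOn_const.mul (hq.add (hq.pow (h - 1)))).mul (hc.sub hε))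
  -- Here the edge ratio is `2` and `q = 1`, and `F` equals `-2 (1 - ε)²` with `ε = 1 / (r + 1)`.
  have hleft : F (cycleRadius k) ≤ 0 := by
    have h2 : decayRate 2 = 1 := by norm_num [decayRate]
    simp only [F, edgeRatio_cycleRadius hk, h2, one_pow]
    nlinarith [sq_nonneg (1 / (cycleRadius k + 1) - 1)]
  have hright : 0 ≤ F (k + 2) := by
    have h3 := three_le_edgeRatio hk
    obtain ⟨q0, q1, -⟩ := decayRate_spec (c := edgeRatio k (k + 2)) (by linarith)
    set q := decayRate (edgeRatio k (k + 2))
    set c := edgeRatio k (k + 2)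
    have hε0 : (0 : ℝ) ≤ 1 / (k + 2 + 1) := by positivity
    have hε1 : (1 : ℝ) / (k + 2 + 1) ≤ 1 := by
      rw [div_le_one (by linarith)]
      linarith
    set ε : ℝ := 1 / (k + 2 + 1)
    obtain ⟨l, rfl⟩ := Nat.exists_eq_add_of_le' hh
    have hql : q ^ l ≤ 1 := pow_le_one₀ q0.le q1
    have hql0 : 0 ≤ q ^ l := pow_nonneg q0.le l
    -- This is `(1 - q)(1 - q ^ l) ≥ 0`; it reduces the sign of `F` to that of `h4`.
    have ht : q + q ^ l ≤ 1 + q ^ (l + 1) := by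
      rw [pow_succ]
      nlinarith [mul_nonneg (sub_nonneg.2 q1) (sub_nonneg.2 hql)]
    have h4 : 0 ≤ (c + ε) * (c - ε) - 1 - 2 * (c - ε) := by nlinarith
    have h5 : 0 ≤ 1 + q ^ (l + 1) := by positivity
    simp only [F, Nat.add_sub_cancel]
    nlinarith [mul_nonneg h4 h5, mul_nonneg (sub_nonneg.2 ht) (show 0 ≤ c - ε by linarith)]
  obtain ⟨r, hr, hFr⟩ := intermediate_value_Icc (cycleRadius_le (k := k) (by omega)) hF
    (show (0 : ℝ) ∈ Set.Icc _ _ from ⟨hleft, hright⟩)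
  have h2 := two_le_edgeRatio hk hr.1
  obtain ⟨q0, q1, hqc⟩ := decayRate_spec h2
  exact ⟨r, decayRate (edgeRatio k r), by linarith [hr.1], q0, q1, h2, hqc, sub_eq_zero.1 hFr⟩

end Parameters

/-! ### Decaying edge weights and the weights near the pendant edge. -/

section Weights

variable {g k : ℕ} {r q : ℝ}

/-- Edge weights on the hypercycle decaying away from its first edge. -/
def decayWeight (g : ℕ) (q : ℝ) (i : Fin g) : ℝ := q ^ (i : ℕ) + q ^ (g - i)

lemma decayWeight_pos (hq : 0 < q) (i : Fin g) : 0 < decayWeight g q i := by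
  rw [decayWeight]
  positivity

lemma decayWeight_succ (i : Fin g) :
    decayWeight g q (cyclicSucc i) = q ^ (i + 1 : ℕ) + q ^ (g - (i + 1)) := by
  rcases (Nat.succ_le_of_lt i.2).lt_or_eq with h | h <;> simp only [Nat.succ_eq_add_one] at h
  · simp [decayWeight, cyclicSucc, Nat.mod_eq_of_lt h]
  · simp [decayWeight, cyclicSucc, h, add_comm]

lemma decayWeight_pred_of_pos {i : Fin g} (hi : 0 < i.val) :
    decayWeight g q ((cyclicPerm g).symm i) = q ^ (i - 1 : ℕ) + q ^ (g - (i - 1)) := by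
  have h : (cyclicPerm g).symm i = ⟨i - 1, by omega⟩ := by
    rw [Equiv.symm_apply_eq]
    ext
    rw [cyclicPerm_val]
    simp only
    rw [Nat.sub_add_cancel hi, Nat.mod_eq_of_lt i.2]
  rw [h, decayWeight]

lemma decayWeight_pred_zero (hg : 2 ≤ g) :
    decayWeight g q ((cyclicPerm g).symm ⟨0, by omega⟩) = q + q ^ (g - 1) := by
  have h : (cyclicPerm g).symm ⟨0, by omega⟩ = ⟨g - 1, by omega⟩ := by
    rw [Equiv.symm_apply_eq]
    ext
    rw [cyclicPerm_val]
    simp only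
    rw [Nat.sub_add_cancel (by omega), Nat.mod_self]
  rw [h, decayWeight, add_comm]
  congr 1
  simp only
  rw [Nat.sub_sub_self (by omega), pow_one]

/-- Both `q ^ i` and `q ^ (-i)` solve the recurrence, and the symmetric combination closes up around
the cycle. Only edge `0`, where the two branches meet in a kink, is excluded. -/
lemma decayWeight_recurrence {c : ℝ} (hc : q ^ 2 + 1 = c * q) {i : Fin g}
    (hi : 0 < i.val) :
    decayWeight g q (cyclicSucc i) + decayWeight g q ((cyclicPerm g).symm i) =
      c * decayWeight g q i := by
  rw [decayWeight_succ, decayWeight_pred_of_pos hi, decayWeight]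
  obtain ⟨a, ha⟩ := Nat.exists_eq_add_of_le' (show 1 ≤ i.val from hi)
  obtain ⟨b, hb⟩ := Nat.exists_eq_add_of_le (show i.val + 1 ≤ g from i.2)
  have h1 : g - (i.val + 1) = b := by omega
  have h2 : g - (i.val - 1) = b + 2 := by omega
  have h3 : g - i.val = b + 1 := by omega
  rw [h1, h2, h3, ha, Nat.add_sub_cancel]
  simp only [pow_succ]
  linear_combination (q ^ a + q ^ b) * hc

/-- The weight of the pendant edge of a lollipop. -/
noncomputable def pendantWeight (g k : ℕ) (r q : ℝ) : ℝ :=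
  (1 + q ^ g) / (edgeRatio k r - 1 / (r + 1))

/-- The extra weight of the vertex at which the pendant edge is attached. -/
noncomputable def rootExcess (g k : ℕ) (r q : ℝ) : ℝ :=
  (1 + q ^ g + pendantWeight g k r q) / (r + 2) - (1 + q ^ g) / (r + 1)

lemma decayWeight_root (hg : 2 ≤ g) (hk : 3 ≤ k) :
    decayWeight g q (lollipopRoot hg hk).1 = 1 + q ^ g := by
  simp [decayWeight, lollipopRoot]

lemma inducedSum_decayWeight_of_ne (hg : 2 ≤ g) (hk : 3 ≤ k) (hr : 0 < r)
    (hc : q ^ 2 + 1 = edgeRatio k r * q) {z : ℝ} {i : Fin g} (hi : i ≠ (lollipopRoot hg hk).1) :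
    inducedSum k r (decayWeight g q) (lollipopRoot hg hk) z i = decayWeight g q i := by
  have hi0 : 0 < i.val := Nat.pos_of_ne_zero fun h => hi (Fin.ext h)
  have h := decayWeight_recurrence hc hi0
  rw [inducedSum, if_neg hi, add_assoc (2 * _), h, edgeRatio]
  field_simp
  ring

/-- The choice of `pendantWeight` and `rootExcess` leaves edge `0` as the only one whose equation
may fail. Its defect is the scalar equation of `exists_lollipop_parameter` for cycle length `g`, up
to a positive factor: zero when `g` is the length for which `r` was found, and nonnegative when `g`
is smaller. -/
lemma inducedSum_decayWeight_root (hg : 2 ≤ g) (hk : 3 ≤ k) (hr : 0 < r)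
    (hc2 : 2 ≤ edgeRatio k r) :
    (r + 2) * (edgeRatio k r - 1 / (r + 1)) *
      (inducedSum k r (decayWeight g q) (lollipopRoot hg hk) (rootExcess g k r q)
        (lollipopRoot hg hk).1 - decayWeight g q (lollipopRoot hg hk).1) =
    2 * (q + q ^ (g - 1)) * (edgeRatio k r - 1 / (r + 1)) -
      ((edgeRatio k r + 1 / (r + 1)) * (edgeRatio k r - 1 / (r + 1)) - 1) * (1 + q ^ g) := by
  have hε : 1 / (r + 1) < 1 := by
    rw [div_lt_one (by linarith)]
    linarith
  have hd : edgeRatio k r - 1 / (r + 1) ≠ 0 := by linarith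
  have hs : pendantWeight g k r q * (edgeRatio k r - 1 / (r + 1)) = 1 + q ^ g :=
    div_mul_cancel₀ _ hd
  have h1 : decayWeight g q (cyclicSucc (lollipopRoot hg hk).1) = q + q ^ (g - 1) := by
    rw [decayWeight_succ]
    simp [lollipopRoot]
  have h2 : decayWeight g q ((cyclicPerm g).symm (lollipopRoot hg hk).1) = q + q ^ (g - 1) :=
    decayWeight_pred_zero hg
  have hR : edgeRatio k r = (r + 2) * (r + 3 - k) / (r + 1) - 2 := rfl
  rw [inducedSum, if_pos rfl, h1, h2, decayWeight_root, rootExcess]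
  set d := edgeRatio k r - 1 / (r + 1) with hd'
  have h3 : edgeRatio k r + 1 / (r + 1) = (r + 2) * (r + 3 - k) / (r + 1) - 2 + 1 / (r + 1) := by
    rw [hR]
  rw [h3]
  generalize pendantWeight g k r q = s at *
  have hs' : (1 + q ^ g) = s * d := hs.symm
  rw [hs']
  generalize q + q ^ (g - 1) = a
  clear_value d
  field_simp
  ring

/-- The vertex equation at the root, which has degree two in the lollipop; this accounts for `r + 2`
in place of `r + 1`. -/
lemma rootExcess_spec (hr : 0 < r) :
    (r + 2) * ((1 + q ^ g) / (r + 1) + rootExcess g k r q) = 1 + q ^ g + pendantWeight g k r q := by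
  rw [rootExcess]
  field_simp
  ring

/-- The pendant edge's equation. Eliminating the root weight by `rootExcess_spec` turns it into `1 +
q ^ g = s (edgeRatio k r - 1 / (r + 1))` for the pendant weight `s`, the source of the definition of
`pendantWeight`. -/
lemma pendantWeight_spec (hr : 0 < r) (hc2 : 2 ≤ edgeRatio k r) :
    (1 + q ^ g) / (r + 1) + rootExcess g k r q +
      ((k : ℝ) - 1) * (pendantWeight g k r q / (r + 1)) = pendantWeight g k r q := by
  have hε : 1 / (r + 1) < 1 := by
    rw [div_lt_one (by linarith)]
    linarith
  have hd : edgeRatio k r - 1 / (r + 1) ≠ 0 := by linarith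
  have hs : pendantWeight g k r q * (edgeRatio k r - 1 / (r + 1)) = 1 + q ^ g :=
    div_mul_cancel₀ _ hd
  rw [rootExcess, ← hs, edgeRatio]
  field_simp
  ring

lemma pendantWeight_pos (hr : 0 < r) (hq : 0 < q) (hc2 : 2 ≤ edgeRatio k r) :
    0 < pendantWeight g k r q := by
  have hε : 1 / (r + 1) < 1 := by
    rw [div_lt_one (by linarith)]
    linarith
  exact div_pos (by positivity) (by linarith)

end Weights

end Hypergraph

namespace Hypergraph

/-! ### Spectral radius of hypercycles and Rayleigh quotients of the test vectors. -/

section Bounds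

variable {α : Type*} {G : Hypergraph α} {g k : ℕ} {φ : Fin g ⊕ Fin g × Fin (k - 2) → α}
  {P : Set α} {r q : ℝ}

/-- For constant edge weights the edge equation is exactly `cycleRadius_sq`; `u` plays no role since
the extra weight is zero. -/
lemma inducedSum_one (hk : 3 ≤ k) (u : Fin g × Fin (k - 2)) (i : Fin g) :
    inducedSum k (cycleRadius k) (fun _ => 1) u 0 i = 1 := by
  have hk' : (3 : ℝ) ≤ k := by exact_mod_cast hk
  have h0 := le_cycleRadius (k := k) (by omega)
  have h1 := cycleRadius_sq (k := k) (by omega)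
  have h2 : cycleRadius k + 2 ≠ 0 := by linarith
  have h3 : cycleRadius k + 1 ≠ 0 := by linarith
  rw [inducedSum, ite_self]
  field_simp
  linear_combination -h1

lemma cycleRadius_pos (hk : 3 ≤ k) : 0 < cycleRadius k := by
  have hk' : (3 : ℝ) ≤ k := by exact_mod_cast hk
  have h0 := le_cycleRadius (k := k) (by omega)
  linarith

theorem specRadius_hypercycle (hg : 2 ≤ g) (hk : 3 ≤ k) :
    (hypercycle g k).specRadius = cycleRadius k / ((k : ℝ) - 1) :=
  specRadius_hypercycle_of_inducedSum hg hk (cycleRadius_pos hk) (fun _ => one_pos)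
    (inducedSum_one hk (lollipopRoot hg hk))

/-- A connected hypergraph with a hypercycle and an edge meeting it in one vertex has a larger
spectral radius than the hypercycle. -/
theorem IsConnected.cycleRadius_lt_specRadius [Finite V(G)] (hc : G.IsConnected) (hg : 2 ≤ g)
    (hk : 3 ≤ k) (hu : G.IsUniform k) (hφ : G.IsCycleEmbedding k g φ)
    {b₀ : Fin g ⊕ Fin g × Fin (k - 2)} (hP : P ∩ Set.range φ = {φ b₀}) (hPE : P ∈ E(G)) :
    cycleRadius k / ((k : ℝ) - 1) < G.specRadius := by
  classical
  have hr := cycleRadius_pos hk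
  have hform := form_inducedWeight (u := lollipopRoot hg hk) (S := fun _ => 1) (z := 0) hg
    (show 2 ≤ k by omega) hr
  simp only [inducedSum_one hk, sub_self, mul_zero, zero_mul, Finset.sum_const_zero] at hform
  -- The eigenvector of the hypercycle extended by zero keeps its Rayleigh quotient, and it vanishes
  -- at the other `k - 1` vertices of `P`.
  refine lt_specRadius_of_pendant (y := 0)
    (x := inducedWeight k (cycleRadius k) (fun _ => 1) (lollipopRoot hg hk) 0) hc hg hk hu hφ hP
    hPE (inducedWeight_pos hr (fun _ => one_pos) (by positivity)) le_rfl hr ?_ (Or.inr ?_)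
  · simp only [mul_zero, add_zero, ne_eq, OfNat.ofNat_ne_zero, not_false_eq_true, zero_pow,
      sub_self]
    linarith
  · have h1 : 0 < (P \ {φ b₀}).ncard := by
      rw [Set.ncard_sdiff_singleton_of_mem (hP.symm.subset rfl).1, hu P hPE]
      omega
    obtain ⟨v, hv⟩ := Set.nonempty_of_ncard_ne_zero h1.ne'
    exact ⟨v, hPE.subset_vertexSet hv.1, pendantVector_of_mem_diff hP hv⟩

/-- The vertex weights on a hypercycle with `g` edges that are used as a test vector. -/
noncomputable def lollipopVector (hg : 2 ≤ g) (hk : 3 ≤ k) (r q : ℝ) :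
    Fin g ⊕ Fin g × Fin (k - 2) → ℝ :=
  inducedWeight k r (decayWeight g q) (lollipopRoot hg hk) (rootExcess g k r q)

lemma lollipopVector_root (hg : 2 ≤ g) (hk : 3 ≤ k) (hr : 0 < r) :
    (r + 2) * lollipopVector hg hk r q (.inr (lollipopRoot hg hk)) =
      1 + q ^ g + pendantWeight g k r q := by
  rw [← rootExcess_spec hr]
  simp [lollipopVector, inducedWeight, decayWeight_root]

lemma lollipopVector_pos (hg : 2 ≤ g) (hk : 3 ≤ k) (hr : 0 < r) (hq : 0 < q)
    (hc2 : 2 ≤ edgeRatio k r) (b : Fin g ⊕ Fin g × Fin (k - 2)) :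
    0 < lollipopVector hg hk r q b := by
  refine inducedWeight_pos hr (decayWeight_pos hq) ?_ b
  have h := rootExcess_spec (g := g) (k := k) (q := q) hr
  have hs := pendantWeight_pos (g := g) hr hq hc2
  rw [decayWeight_root]
  refine pos_of_mul_pos_right (a := r + 2) ?_ (by linarith)
  rw [h]
  positivity

open Classical in
/-- The test vector extended by a pendant edge at `b₀` has Rayleigh quotient at least `r`, as soon
as it is at least as large at `b₀` as at the root. -/
lemma lollipopVector_form (hg : 2 ≤ g) (hk : 3 ≤ k) (hr : 0 < r) (hq : 0 < q)
    (hc2 : 2 ≤ edgeRatio k r) (hc : q ^ 2 + 1 = edgeRatio k r * q)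
    (hle : ((edgeRatio k r + 1 / (r + 1)) * (edgeRatio k r - 1 / (r + 1)) - 1) * (1 + q ^ g) ≤
      2 * (q + q ^ (g - 1)) * (edgeRatio k r - 1 / (r + 1)))
    (b₀ : Fin g ⊕ Fin g × Fin (k - 2)) :
    r * (∑ b, lollipopVector hg hk r q b ^ 2 +
        ((k : ℝ) - 1) * (pendantWeight g k r q / (r + 1)) ^ 2) +
      2 * (((k : ℝ) - 1) * (pendantWeight g k r q / (r + 1))) *
        (lollipopVector hg hk r q b₀ - lollipopVector hg hk r q (.inr (lollipopRoot hg hk))) ≤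
    ∑ i, ((∑ b, if b ∈ hypercycleEdge g k i then lollipopVector hg hk r q b else 0) ^ 2 -
        ∑ b, if b ∈ hypercycleEdge g k i then lollipopVector hg hk r q b ^ 2 else 0) +
      ((lollipopVector hg hk r q b₀ + ((k : ℝ) - 1) * (pendantWeight g k r q / (r + 1))) ^ 2 -
        (lollipopVector hg hk r q b₀ ^ 2 +
          ((k : ℝ) - 1) * (pendantWeight g k r q / (r + 1)) ^ 2)) := by
  set u := lollipopRoot hg hk with hu
  have hform := form_inducedWeight (u := u) (S := decayWeight g q) (z := rootExcess g k r q) hg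
    (show 2 ≤ k by omega) hr
  have hsum := Finset.sum_eq_single (s := Finset.univ) (f := fun i =>
    inducedSum k r (decayWeight g q) u (rootExcess g k r q) i *
      (inducedSum k r (decayWeight g q) u (rootExcess g k r q) i - decayWeight g q i)) u.1
    (fun i _ hi => by
      rw [inducedSum_decayWeight_of_ne hg hk hr hc hi, sub_self, mul_zero]) (by simp)
  rw [hsum] at hform
  have hT := inducedSum_decayWeight_root (q := q) hg hk hr hc2
  have hε : 1 / (r + 1) < 1 := by
    rw [div_lt_one (by linarith)]
    linarith
  have hd : 0 < (r + 2) * (edgeRatio k r - 1 / (r + 1)) :=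
    mul_pos (by linarith) (by linarith)
  set T := inducedSum k r (decayWeight g q) u (rootExcess g k r q) u.1 with hTdef
  -- The only place where `hle` enters: the defect at edge `0` has the favourable sign.
  have hT0 : 0 ≤ T - decayWeight g q u.1 := by
    refine le_of_mul_le_mul_left ?_ hd
    rw [mul_zero, hT]
    linarith
  have hS0 : 0 < decayWeight g q u.1 := decayWeight_pos hq _
  have hTT : 0 ≤ T * (T - decayWeight g q u.1) := mul_nonneg (by linarith) hT0
  have hxu := lollipopVector_root (q := q) hg hk hr
  have hpend := pendantWeight_spec (g := g) (k := k) (q := q) hr hc2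
  have hxu2 : lollipopVector hg hk r q (.inr u) = (1 + q ^ g) / (r + 1) + rootExcess g k r q := by
    simp [lollipopVector, inducedWeight, hu, decayWeight_root]
  rw [← hxu2] at hpend
  have hz : (r + 1) * rootExcess g k r q =
      pendantWeight g k r q - lollipopVector hg hk r q (.inr u) := by
    have : (r + 1) * ((1 + q ^ g) / (r + 1)) = 1 + q ^ g := by field_simp
    have h2 : (r + 1) * lollipopVector hg hk r q (.inr u) =
        1 + q ^ g + (r + 1) * rootExcess g k r q := by rw [hxu2, mul_add, this]
    linarith
  have hy : (r + 1) * (pendantWeight g k r q / (r + 1)) = pendantWeight g k r q := by field_simp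
  rw [show inducedWeight k r (decayWeight g q) u (rootExcess g k r q) =
    lollipopVector hg hk r q from rfl] at hform
  rw [hz] at hform
  generalize pendantWeight g k r q / (r + 1) = y at *
  generalize lollipopVector hg hk r q (.inr u) = xu at *
  rw [← hy] at hform hpend
  have key : ((k : ℝ) - 1) * y * (xu + ((k : ℝ) - 1) * y - (r + 1) * y) = 0 := by
    rw [hpend, sub_self, mul_zero]
  -- By the pendant edge's equation, the term lost through the extra root weight is matched by the
  -- form of the attached edge, except for the difference between the weights at `b₀` and at the
  -- root.
  have h3 : (r + 1) * y - xu = ((k : ℝ) - 1) * y := by linarith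
  rw [h3] at hform
  nlinarith

/-- Both vertices have degree two with the pendant edge at the root, so it suffices that the pendant
weight be below `q + q ^ (g - 1)`, the weight of the edge preceding edge `0`. This follows from
`hle`, because the coefficient of `1 + q ^ g` there exceeds `2`. -/
lemma lollipopVector_root_lt (hg : 2 ≤ g) (hk : 3 ≤ k) (hr : 0 < r) (hq : 0 < q)
    (hc2 : 2 ≤ edgeRatio k r)
    (hle : ((edgeRatio k r + 1 / (r + 1)) * (edgeRatio k r - 1 / (r + 1)) - 1) * (1 + q ^ g) ≤
      2 * (q + q ^ (g - 1)) * (edgeRatio k r - 1 / (r + 1))) :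
    lollipopVector hg hk r q (.inr (lollipopRoot hg hk)) <
      lollipopVector hg hk r q (.inl ⟨0, by omega⟩) := by
  have hε0 : 0 < 1 / (r + 1) := by positivity
  have hε : 1 / (r + 1) < 1 := by
    rw [div_lt_one (by linarith)]
    linarith
  have hw : (r + 2) * lollipopVector hg hk r q (.inl ⟨0, by omega⟩) =
      1 + q ^ g + (q + q ^ (g - 1)) := by
    simp only [lollipopVector, inducedWeight, Sum.elim_inl, decayWeight_pred_zero hg]
    simp only [decayWeight, pow_zero, Nat.sub_zero]
    field_simp
  have hu := lollipopVector_root (q := q) hg hk hr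
  refine lt_of_mul_lt_mul_left (a := r + 2) ?_ (by linarith)
  rw [hu, hw, add_lt_add_iff_left, pendantWeight, div_lt_iff₀ (by linarith)]
  set c := edgeRatio k r
  set ε := 1 / (r + 1)
  have h1 : 0 < 1 + q ^ g := by positivity
  have h2 : 3 < (c + ε) * (c - ε) := by nlinarith
  nlinarith [mul_pos (sub_pos.2 h2) h1]

end Bounds

/-! ### Relabelling, pendant edges and recognition of hypercycles and lollipops. -/

section Structure

variable {α β : Type*} {G : Hypergraph α} {g k : ℕ} {φ : Fin g ⊕ Fin g × Fin (k - 2) → α}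

lemma IsIsomorphic.symm {H : Hypergraph α} {K : Hypergraph β} (hH : V(H).Nonempty)
    (h : H.IsIsomorphic K) : K.IsIsomorphic H := by
  obtain ⟨f, hV, hE⟩ := h
  have : Nonempty α := ⟨hH.some⟩
  have hinv : Set.InvOn (Function.invFunOn f V(H)) f V(H) V(K) := hV.invOn_invFunOn
  have himg : Set.InvOn (Set.image (Function.invFunOn f V(H))) (Set.image f) E(H) E(K) := by
    constructor
    · intro e he
      rw [Set.image_image]
      exact (Set.image_congr fun a ha => hinv.1 (he.subset_vertexSet ha)).trans (Set.image_id _)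
    · intro e he
      rw [Set.image_image]
      exact (Set.image_congr fun a ha => hinv.2 (he.subset_vertexSet ha)).trans (Set.image_id _)
  exact ⟨_, hV.symm hinv.symm, hE.symm himg.symm⟩

lemma isIsomorphic_of_injective {H : Hypergraph β} {ψ : β → α} (hψ : ψ.Injective)
    (hV : ψ '' V(H) = V(G)) (hE : Set.image ψ '' E(H) = E(G)) : H.IsIsomorphic G :=
  ⟨ψ, hV ▸ hψ.injOn.bijOn_image, hE ▸ (Set.image_injective.2 hψ).injOn.bijOn_image⟩

/-- The edges of an embedded hypercycle. -/
def cycleEdges (φ : Fin g ⊕ Fin g × Fin (k - 2) → α) : Set (Set α) :=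
  Set.range fun i => φ '' hypercycleEdge g k i

lemma sUnion_cycleEdges : ⋃₀ cycleEdges φ = Set.range φ := by
  rw [cycleEdges, Set.sUnion_range, ← Set.image_iUnion, iUnion_hypercycleEdge, Set.image_univ]

lemma ncard_cycleEdges (hk : 3 ≤ k) (hφ : φ.Injective) : (cycleEdges φ).ncard = g :=
  (ncard_range_of_injective
    ((Set.image_injective.2 hφ).comp (hypercycleEdge_injective hk))).trans (Nat.card_fin g)

lemma ncard_range_cycle (hk : 2 ≤ k) (hφ : φ.Injective) : (Set.range φ).ncard = (k - 1) * g := by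
  rw [ncard_range_of_injective hφ, card_hypercycleVertex hk]

lemma IsCycleEmbedding.cycleEdges_subset (hφ : G.IsCycleEmbedding k g φ) :
    cycleEdges φ ⊆ E(G) := by
  rintro _ ⟨i, rfl⟩
  exact hφ.image_mem i

/-- A hypercycle can be relabelled so that a given vertex becomes the first junction vertex or the
root of the lollipop. -/
lemma IsCycleEmbedding.exists_relabel (hg : 2 ≤ g) (hk : 3 ≤ k) (hφ : G.IsCycleEmbedding k g φ)
    (b₀ : Fin g ⊕ Fin g × Fin (k - 2)) :
    ∃ φ', G.IsCycleEmbedding k g φ' ∧ Set.range φ' = Set.range φ ∧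
      (φ' (.inl ⟨0, by omega⟩) = φ b₀ ∨ φ' (.inr (lollipopRoot hg hk)) = φ b₀) := by
  have hmain : ∀ (i : Fin g) (j : Fin (k - 2)), ∃ φ', G.IsCycleEmbedding k g φ' ∧
      Set.range φ' = Set.range φ ∧ φ' (.inl ⟨0, by omega⟩) = φ (.inl i) ∧
      φ' (.inr (lollipopRoot hg hk)) = φ (.inr (i, j)) := fun i j => by
    -- A rotation taking edge `0` to edge `i`, combined with a transposition of the vertices of
    -- degree one inside each edge, is a symmetry of the hypercycle.
    let τ : Equiv.Perm (Fin g) := cyclicPerm g ^ (i : ℕ)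
    let π : Equiv.Perm (Fin (k - 2)) := Equiv.swap ⟨0, by omega⟩ j
    have hτ0 : τ ⟨0, by omega⟩ = i := by
      ext
      rw [cyclicPerm_pow_zero, Nat.mod_eq_of_lt i.2]
    have hτ : ∀ l, τ (cyclicSucc l) = cyclicSucc (τ l) := fun l => by
      have h : Commute τ (cyclicPerm g) := Commute.pow_self _ _
      exact DFunLike.congr_fun h.eq l
    let E : Equiv.Perm (Fin g ⊕ Fin g × Fin (k - 2)) := Equiv.sumCongr τ (Equiv.prodCongr τ π)
    have hE : ∀ l, E '' hypercycleEdge g k l = hypercycleEdge g k (τ l) := fun l => by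
      have h1 : (E ∘ fun j => Sum.inr (l, j)) =
          (fun j => Sum.inr (τ l, j) : Fin (k - 2) → Fin g ⊕ Fin g × Fin (k - 2)) ∘ π := rfl
      have h2 : E (.inl l) = .inl (τ l) := rfl
      have h3 : E (.inl (cyclicSucc l)) = .inl (cyclicSucc (τ l)) := congrArg Sum.inl (hτ l)
      rw [hypercycleEdge, Set.image_union, Set.image_pair, ← Set.range_comp, h1,
        π.surjective.range_comp, h2, h3, hypercycleEdge]
    refine ⟨φ ∘ E, ⟨hφ.injective.comp E.injective, fun l => ?_⟩, E.surjective.range_comp φ, ?_, ?_⟩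
    · rw [Set.image_comp, hE]
      exact hφ.image_mem _
    · exact congrArg (fun a => φ (.inl a)) hτ0
    · have h1 : π ⟨0, by omega⟩ = j := Equiv.swap_apply_left _ _
      exact congrArg₂ (fun a c => φ (.inr (a, c))) hτ0 h1
  rcases b₀ with i | ⟨i, j⟩
  · obtain ⟨φ', h1, h2, h3, -⟩ := hmain i ⟨0, by omega⟩
    exact ⟨φ', h1, h2, Or.inl h3⟩
  · obtain ⟨φ', h1, h2, -, h3⟩ := hmain i j
    exact ⟨φ', h1, h2, Or.inr h3⟩

/-- Connectedness gives a further edge meeting the cycle. The cycle covers exactly `(k - 1) g`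
vertices and together with this edge at least `(k - 1)(g + 1)`, so the intersection is a single
vertex. -/
lemma IsUnicyclic.exists_pendant (hG : G.IsUnicyclic k) (hg : 2 ≤ g) (hk : 3 ≤ k)
    (hφ : G.IsCycleEmbedding k g φ) (hne : cycleEdges φ ≠ E(G)) :
    ∃ P ∈ E(G), ∃ b₀, P ∩ Set.range φ = {φ b₀} := by
  have := hG.finite.to_subtype
  have hFf : (cycleEdges φ).Finite := Set.finite_range _
  obtain ⟨P, hP, hPF, hPm⟩ := hG.connected.exists_edge_meeting (by omega) hG.uniform
    hφ.cycleEdges_subset ⟨_, ⟨0, by omega⟩, rfl⟩ hne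
  have hle := hG.le_ncard_sUnion (by omega) (Set.insert_subset hP hφ.cycleEdges_subset)
    (Set.insert_nonempty _ _)
  have hPf := finite_of_mem_edgeSet hP
  rw [Set.ncard_insert_of_notMem hPF hFf, ncard_cycleEdges hk hφ.injective, Set.sUnion_insert,
    sUnion_cycleEdges] at hle
  rw [sUnion_cycleEdges] at hPm
  have h3 := Set.ncard_union_add_ncard_inter P (Set.range φ) hPf (Set.finite_range φ)
  have h4 : 0 < (P ∩ Set.range φ).ncard := (Set.ncard_pos (hPf.inter_of_left _)).2 hPm
  rw [hG.uniform P hP, ncard_range_cycle (by omega) hφ.injective] at h3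
  have h5 : (k - 1) * (g + 1) = (k - 1) * g + (k - 1) := by ring
  obtain ⟨p, hp⟩ := Set.ncard_eq_one.1 (show (P ∩ Set.range φ).ncard = 1 by omega)
  obtain ⟨b, rfl⟩ := (hp.symm.subset rfl).2
  exact ⟨P, hP, b, hp⟩

lemma IsCycleEmbedding.isIsomorphic_hypercycle (hφ : G.IsCycleEmbedding k g φ)
    (hc : G.IsConnected) (hg : 2 ≤ g) (hk : 1 ≤ k) (hu : G.IsUniform k)
    (h : cycleEdges φ = E(G)) : G.IsIsomorphic (hypercycle g k) := by
  have h0 : E(G).Nonempty := ⟨_, hφ.image_mem ⟨0, by omega⟩⟩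
  refine IsIsomorphic.symm ⟨.inl ⟨0, by omega⟩, Set.mem_univ _⟩
    (isIsomorphic_of_injective hφ.injective ?_ ?_)
  · rw [vertexSet_hypercycle, Set.image_univ, ← sUnion_cycleEdges, h,
      hc.sUnion_edgeSet hk hu h0]
  · rw [edgeSet_hypercycle, ← Set.range_comp, ← h]
    rfl

/-- The edge count leaves no edge besides `P` and those of the cycle; any enumeration of `P` without
its root extends `φ` to the lollipop. -/
lemma IsCycleEmbedding.isIsomorphic_lollipopTwo [Finite V(G)] (hφ : G.IsCycleEmbedding k g φ)
    (hg : 2 ≤ g) (hk : 3 ≤ k) (hu : G.IsUniform k) {P : Set α} (hPE : P ∈ E(G))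
    (hP : P ∩ Set.range φ = {φ (.inr (lollipopRoot hg hk))})
    (hV : V(G) ⊆ Set.range φ ∪ P) (hE : E(G).ncard = g + 1) :
    G.IsIsomorphic (lollipopTwo g k 1 hg hk) := by
  set p := φ (.inr (lollipopRoot hg hk)) with hp
  have hpP : p ∈ P := (hP.symm.subset rfl).1
  have hPf := finite_of_mem_edgeSet hPE
  have hPF : P ∉ cycleEdges φ := fun ⟨i, hi⟩ => image_hypercycleEdge_ne hg hφ.injective hP i hi
  have hEeq : insert P (cycleEdges φ) = E(G) := by
    refine Set.eq_of_subset_of_ncard_le (Set.insert_subset hPE hφ.cycleEdges_subset) ?_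
      finite_edgeSet
    rw [Set.ncard_insert_of_notMem hPF (Set.finite_range _), ncard_cycleEdges hk hφ.injective, hE]
  obtain ⟨f, hfinj, hf⟩ := exists_injective_range_eq (ι := Fin 1 ⊕ Fin 1 × Fin (k - 2))
    (hPf.subset Set.sdiff_subset : (P \ {p}).Finite) (by
      rw [Set.ncard_sdiff_singleton_of_mem hpP, hu P hPE, card_pendantVertex hk])
  have hψ : Function.Injective (Sum.elim φ f) := by
    refine hφ.injective.sumElim hfinj fun b b' h => ?_
    have h1 : f b' ∈ P \ {p} := hf ▸ Set.mem_range_self b'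
    exact h1.2 (hP ▸ ⟨h1.1, h ▸ Set.mem_range_self b⟩)
  refine IsIsomorphic.symm (isConnected_lollipopTwo hg hk).1
    (isIsomorphic_of_injective hψ ?_ ?_)
  · rw [vertexSet_lollipopTwo, Set.image_univ, Set.Sum.elim_range, hf]
    refine subset_antisymm (Set.union_subset ?_ (Set.sdiff_subset.trans hPE.subset_vertexSet))
      fun v hv => ?_
    · rw [← sUnion_cycleEdges]
      exact (Set.sUnion_mono hφ.cycleEdges_subset).trans sUnion_edgeSet_subset_vertexSet
    · by_cases h : v ∈ Set.range φ
      · exact Or.inl h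
      · exact Or.inr ⟨(hV hv).resolve_left h, fun h2 => h (h2 ▸ Set.mem_range_self _)⟩
  · have hnone : Sum.elim φ f '' lollipopEdge hg hk none = P := by
      rw [lollipopEdge, Option.elim_none, Set.image_insert_eq, ← Set.range_comp,
        Sum.elim_comp_inr, hf, Sum.elim_inl, ← hp, Set.insert_sdiff_singleton,
        Set.insert_eq_of_mem hpP]
    have hsome : ∀ i, Sum.elim φ f '' lollipopEdge hg hk (some i) = φ '' hypercycleEdge g k i :=
      fun i => by
        rw [lollipopEdge, Option.elim_some, Set.image_image]
        rfl
    rw [edgeSet_lollipopTwo, ← hEeq, ← Set.range_comp]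
    ext s
    constructor
    · rintro ⟨_ | i, rfl⟩
      · exact Or.inl hnone
      · exact Or.inr ⟨i, (hsome i).symm⟩
    · rintro (rfl | ⟨i, rfl⟩)
      · exact ⟨none, hnone⟩
      · exact ⟨some i, hsome i⟩

end Structure

end Hypergraph

namespace Hypergraph

/-! ### Comparison with the hypercycle and with the lollipop. -/

section Extremal

variable {α : Type*} {G : Hypergraph α} {k : ℕ}

lemma IsUnicyclic.cycleEdges_ne {g : ℕ} {φ : Fin g ⊕ Fin g × Fin (k - 2) → α}
    (hG : G.IsUnicyclic k) (hg : 2 ≤ g) (hk : 3 ≤ k) (hφ : G.IsCycleEmbedding k g φ)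
    (h : ¬ G.IsIsomorphic (hypercycle E(G).ncard k)) : cycleEdges φ ≠ E(G) := fun heq => by
  rw [← heq, ncard_cycleEdges hk hφ.injective] at h
  exact h (hφ.isIsomorphic_hypercycle hG.connected hg (by omega) hG.uniform heq)

lemma IsUnicyclic.cycleRadius_lt_specRadius [Finite V(G)] (hG : G.IsUnicyclic k) (hk : 3 ≤ k)
    (h : ¬ G.IsIsomorphic (hypercycle E(G).ncard k)) :
    cycleRadius k / ((k : ℝ) - 1) < G.specRadius := by
  obtain ⟨g, hg, φ, hφ⟩ := hG.exists_isCycleEmbedding (show 2 ≤ k by omega)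
  have hne := hG.cycleEdges_ne hg hk hφ h
  obtain ⟨P, hPE, b₀, hP⟩ := hG.exists_pendant hg hk hφ hne
  exact hG.connected.cycleRadius_lt_specRadius hg hk hG.uniform hφ hP hPE

lemma IsUnicyclic.two_le_ncard_edgeSet (hG : G.IsUnicyclic k) (hk : 3 ≤ k) :
    2 ≤ E(G).ncard := by
  have := hG.finite.to_subtype
  obtain ⟨g, hg, φ, hφ⟩ := hG.exists_isCycleEmbedding (show 2 ≤ k by omega)
  have h := Set.ncard_le_ncard hφ.cycleEdges_subset finite_edgeSet
  rw [ncard_cycleEdges hk hφ.injective] at h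
  omega

/-- An embedded hypercycle has at least two edges and, the hypergraph not being a hypercycle, omits
at least one. This makes the lollipop in part (2) meaningful. -/
lemma IsUnicyclic.three_le_ncard_edgeSet (hG : G.IsUnicyclic k) (hk : 3 ≤ k)
    (h : ¬ G.IsIsomorphic (hypercycle E(G).ncard k)) : 3 ≤ E(G).ncard := by
  have := hG.finite.to_subtype
  obtain ⟨g, hg, φ, hφ⟩ := hG.exists_isCycleEmbedding (show 2 ≤ k by omega)
  have hlt := Set.ncard_lt_ncard
    (hφ.cycleEdges_subset.ssubset_of_ne (hG.cycleEdges_ne hg hk hφ h)) finite_edgeSet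
  rw [ncard_cycleEdges hk hφ.injective] at hlt
  omega

lemma cycleRadius_lt_specRadius_lollipopTwo {h : ℕ} (hh : 2 ≤ h) (hk : 3 ≤ k) :
    cycleRadius k / ((k : ℝ) - 1) < (lollipopTwo h k 1 hh hk).specRadius := by
  refine (isConnected_lollipopTwo hh hk).cycleRadius_lt_specRadius hh hk
    (isUniform_lollipopTwo hh hk) (isCycleEmbedding_lollipopTwo hh hk)
    (lollipopEdge_none_inter hh hk) ?_
  rw [edgeSet_lollipopTwo]
  exact Set.mem_range_self _

/-- Among the unicyclic hypergraphs that are not hypercycles, the lollipop has the least spectral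
radius. -/
theorem IsUnicyclic.specRadius_lollipopTwo_lt [Finite V(G)] (hG : G.IsUnicyclic k) (hk : 3 ≤ k)
    {h : ℕ} (hh : 2 ≤ h) (hE : E(G).ncard = h + 1)
    (hcyc : ¬ G.IsIsomorphic (hypercycle E(G).ncard k))
    (hlop : ¬ G.IsIsomorphic (lollipopTwo h k 1 hh hk)) :
    (lollipopTwo h k 1 hh hk).specRadius < G.specRadius := by
  classical
  have hk' : 0 < (k : ℝ) - 1 := by
    have : (3 : ℝ) ≤ k := by exact_mod_cast hk
    linarith
  obtain ⟨r, q, hr, hq, hq1, hc2, hc, hroot⟩ := exists_lollipop_parameter hk (h := h) (by omega)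
  have hε : 1 / (r + 1) < 1 := by
    rw [div_lt_one (by linarith)]
    linarith
  have hrad : (lollipopTwo h k 1 hh hk).specRadius = r / ((k : ℝ) - 1) := by
    refine specRadius_lollipopTwo_of_inducedSum hh hk hr (S := decayWeight h q)
      (decayWeight_pos hq) (s := pendantWeight h k r q) (z := rootExcess h k r q)
      (pendantWeight_pos hr hq hc2) (fun i => ?_) ?_ ?_
    · by_cases hi : i = (lollipopRoot hh hk).1
      · subst hi
        have hT := inducedSum_decayWeight_root (q := q) hh hk hr hc2
        rw [← hroot, sub_self] at hT
        have hd : (r + 2) * (edgeRatio k r - 1 / (r + 1)) ≠ 0 :=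
          (mul_pos (by linarith) (by linarith)).ne'
        exact sub_eq_zero.1 ((mul_eq_zero.1 hT).resolve_left hd)
      · exact inducedSum_decayWeight_of_ne hh hk hr hc hi
    · rw [decayWeight_root]
      exact rootExcess_spec hr
    · rw [decayWeight_root]
      exact pendantWeight_spec hr hc2
  rw [hrad]
  obtain ⟨g, hg, φ₀, hφ₀⟩ := hG.exists_isCycleEmbedding (show 2 ≤ k by omega)
  have hne := hG.cycleEdges_ne hg hk hφ₀ hcyc
  have hgh : g ≤ h := by
    have hlt := Set.ncard_lt_ncard (hφ₀.cycleEdges_subset.ssubset_of_ne hne) finite_edgeSet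
    rw [ncard_cycleEdges hk hφ₀.injective, hE] at hlt
    omega
  obtain ⟨P, hPE, b₀, hP⟩ := hG.exists_pendant hg hk hφ₀ hne
  obtain ⟨φ, hφ, hrange, hb₀⟩ := hφ₀.exists_relabel hg hk b₀
  rw [← hrange] at hP
  -- The equation satisfied by `r` at length `h` becomes an inequality at length `g ≤ h` by
  -- `decay_add_le`.
  have hle : ((edgeRatio k r + 1 / (r + 1)) * (edgeRatio k r - 1 / (r + 1)) - 1) * (1 + q ^ g) ≤
      2 * (q + q ^ (g - 1)) * (edgeRatio k r - 1 / (r + 1)) := by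
    have h1 := decay_add_le hq.le hq1 (show 1 ≤ g by omega) hgh
    have h2 : 0 < edgeRatio k r - 1 / (r + 1) := by linarith
    have h3 : 0 < 1 + q ^ h := by positivity
    refine le_of_mul_le_mul_right ?_ h3
    have h4 := mul_le_mul_of_nonneg_right h1 h2.le
    calc _ = ((edgeRatio k r + 1 / (r + 1)) * (edgeRatio k r - 1 / (r + 1)) - 1) * (1 + q ^ h) *
          (1 + q ^ g) := by ring
      _ = 2 * ((q + q ^ (h - 1)) * (1 + q ^ g) * (edgeRatio k r - 1 / (r + 1))) := by
          rw [hroot]; ring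
      _ ≤ 2 * ((q + q ^ (g - 1)) * (1 + q ^ h) * (edgeRatio k r - 1 / (r + 1))) := by linarith
      _ = _ := by ring
  have hform := lollipopVector_form hg hk hr hq hc2 hc hle
  have hpos := lollipopVector_pos hg hk hr hq hc2
  have hy : 0 < pendantWeight g k r q / (r + 1) :=
    div_pos (pendantWeight_pos hr hq hc2) (by linarith)
  rcases hb₀ with hb₀ | hb₀ <;> rw [← hb₀] at hP
  -- `P` hangs at a junction, where the test vector exceeds its value at the root; the cross term
  -- gives a strict gain.
  · have hlt := hform (.inl ⟨0, by omega⟩)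
    have hgain := mul_pos (mul_pos two_pos (mul_pos hk' hy))
      (sub_pos.2 (lollipopVector_root_lt hg hk hr hq hc2 hle))
    have hlt' := (lt_add_of_pos_right _ hgain).trans_le hlt
    exact lt_specRadius_of_pendant hG.connected hg hk hG.uniform hφ hP hPE hpos hy.le hr hlt'.le
      (Or.inl hlt')
  -- `P` hangs at the root. The Rayleigh quotient may equal `r`, so strictness must come from a
  -- vertex outside the cycle and `P`; without such a vertex the hypergraph is the lollipop.
  · have hform' := hform (.inr (lollipopRoot hg hk))
    rw [sub_self, mul_zero, add_zero] at hform'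
    refine lt_specRadius_of_pendant hG.connected hg hk hG.uniform hφ hP hPE hpos hy.le hr hform'
      (Or.inr ?_)
    by_contra hcon
    have hV : V(G) ⊆ Set.range φ ∪ P := fun v hv => by
      by_contra hvn
      rw [Set.mem_union, not_or] at hvn
      exact hcon ⟨v, hv, by rw [pendantVector_of_notMem hvn.1, Set.indicator_of_notMem hvn.2]⟩
    -- The cycle and `P` have `(k - 1)(g + 1)` vertices together, which must reach the order `(k -
    -- 1)(h + 1)`.
    have hgeq : g = h := by
      have h1 := Set.ncard_le_ncard hV
        ((Set.finite_range φ).union (finite_of_mem_edgeSet hPE))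
      have h2 := Set.ncard_union_add_ncard_inter P (Set.range φ) (finite_of_mem_edgeSet hPE)
        (Set.finite_range φ)
      rw [hP, Set.ncard_singleton, hG.uniform P hPE,
        ncard_range_cycle (by omega) hφ.injective, Set.union_comm] at h2
      rw [hG.ncard_eq (by omega), hE] at h1
      have h3 : (k - 1) * (h + 1) ≤ (k - 1) * (g + 1) := by
        rw [mul_add (k - 1) g]
        omega
      have := Nat.le_of_mul_le_mul_left h3 (by omega)
      omega
    subst hgeq
    exact hlop (hφ.isIsomorphic_lollipopTwo hg hk hG.uniform hPE hP hV hE)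

end Extremal

end Hypergraph

theorem theorem1p2 {α : Type*} (k n : ℕ) (hk : 3 ≤ k) (G : Hypergraph α) [Finite V(G)]
    (hG : G.IsUnicyclic k) (hn : V(G).ncard = n) :
    ∃ m : ℕ, 2 ≤ m ∧ (m : ℚ) = (n : ℚ) / ((k : ℚ) - 1) ∧
      -- the hypercycle of order `n` is itself a `k`-uniform unicyclic hypergraph of order `n`
      ((Hypergraph.hypercycle m k).IsUnicyclic k ∧ V(Hypergraph.hypercycle m k).ncard = n) ∧
      -- part (1)
      ((((k : ℝ) - 1) + √(((k : ℝ) - 1) ^ 2 + 8 * ((k : ℝ) - 1))) / (2 * ((k : ℝ) - 1))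
          ≤ G.specRadius ∧
        (G.specRadius =
            (((k : ℝ) - 1) + √(((k : ℝ) - 1) ^ 2 + 8 * ((k : ℝ) - 1))) / (2 * ((k : ℝ) - 1)) ↔
          G.IsIsomorphic (Hypergraph.hypercycle m k))) ∧
      -- part (2)
      (¬ G.IsIsomorphic (Hypergraph.hypercycle m k) →
        ∃ (g : ℕ) (hg : 2 ≤ g), (g : ℚ) = ((n : ℚ) - k + 1) / ((k : ℚ) - 1) ∧
          -- the lollipop belongs to the class over which the minimum is taken
          ((Hypergraph.lollipopTwo g k 1 hg hk).IsUnicyclic k ∧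
            V(Hypergraph.lollipopTwo g k 1 hg hk).ncard = n ∧
            ¬ (Hypergraph.lollipopTwo g k 1 hg hk).IsIsomorphic (Hypergraph.hypercycle m k)) ∧
          (Hypergraph.lollipopTwo g k 1 hg hk).specRadius ≤ G.specRadius ∧
          (G.specRadius = (Hypergraph.lollipopTwo g k 1 hg hk).specRadius ↔
            G.IsIsomorphic (Hypergraph.lollipopTwo g k 1 hg hk))) := by
  have hk1 : 1 ≤ k := by omega
  have hkR : (0 : ℝ) < (k : ℝ) - 1 := by
    have : (3 : ℝ) ≤ k := by exact_mod_cast hk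
    linarith
  have hkQ : ((k : ℚ) - 1) ≠ 0 := by
    have : (3 : ℚ) ≤ k := by exact_mod_cast hk
    linarith
  have hnm : n = (k - 1) * E(G).ncard := hn ▸ hG.ncard_eq hk1
  have hnQ : (n : ℚ) = ((k : ℚ) - 1) * (E(G).ncard : ℚ) := by
    rw [hnm]
    push_cast [hk1]
    ring
  have hm2 := hG.two_le_ncard_edgeSet hk
  have hrad : (((k : ℝ) - 1) + √(((k : ℝ) - 1) ^ 2 + 8 * ((k : ℝ) - 1))) / (2 * ((k : ℝ) - 1)) =
      Hypergraph.cycleRadius k / ((k : ℝ) - 1) := by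
    rw [Hypergraph.cycleRadius, div_div]
  have hiso : G.IsIsomorphic (Hypergraph.hypercycle E(G).ncard k) →
      G.specRadius = Hypergraph.cycleRadius k / ((k : ℝ) - 1) := fun h => by
    rw [h.specRadius_eq hG.uniform (Hypergraph.isUniform_hypercycle hm2 (by omega)),
      Hypergraph.specRadius_hypercycle hm2 hk]
  rw [hrad]
  refine ⟨E(G).ncard, hm2, ?_, ⟨Hypergraph.isUnicyclic_hypercycle hm2 hk, ?_⟩, ⟨?_, ?_, hiso⟩,
    fun hnot => ?_⟩
  · rw [hnQ, mul_div_cancel_left₀ _ hkQ]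
  · rw [Hypergraph.ncard_vertexSet_hypercycle (by omega), hnm]
  · by_cases h : G.IsIsomorphic (Hypergraph.hypercycle E(G).ncard k)
    · exact (hiso h).ge
    · exact (hG.cycleRadius_lt_specRadius hk h).le
  · intro heq
    by_contra h
    exact (hG.cycleRadius_lt_specRadius hk h).ne' heq
  · have hm3 := hG.three_le_ncard_edgeSet hk hnot
    obtain ⟨g, hgm⟩ := Nat.exists_eq_add_of_le' (show 1 ≤ E(G).ncard by omega)
    have hg : 2 ≤ g := by omega
    have hlop : G.IsIsomorphic (Hypergraph.lollipopTwo g k 1 hg hk) →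
        G.specRadius = (Hypergraph.lollipopTwo g k 1 hg hk).specRadius := fun h =>
      h.specRadius_eq hG.uniform (Hypergraph.isUniform_lollipopTwo hg hk)
    refine ⟨g, hg, ?_, ⟨Hypergraph.isUnicyclic_lollipopTwo hg hk, ?_, fun h => ?_⟩, ?_, ?_, hlop⟩
    · rw [eq_div_iff hkQ, hnQ, hgm]
      push_cast
      ring
    · rw [Hypergraph.ncard_vertexSet_lollipopTwo, hnm, hgm]
    -- The lollipop is told apart from the hypercycle by its larger spectral radius.
    · have h1 := Hypergraph.cycleRadius_lt_specRadius_lollipopTwo hg hk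
      rw [h.specRadius_eq (Hypergraph.isUniform_lollipopTwo hg hk)
        (Hypergraph.isUniform_hypercycle hm2 (by omega)),
        Hypergraph.specRadius_hypercycle hm2 hk] at h1
      exact lt_irrefl _ h1
    · by_cases h : G.IsIsomorphic (Hypergraph.lollipopTwo g k 1 hg hk)
      · exact (hlop h).ge
      · exact (hG.specRadius_lollipopTwo_lt hk hg hgm hnot h).le
    · intro heq
      by_contra h
      exact (hG.specRadius_lollipopTwo_lt hk hg hgm hnot h).ne' heq
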